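/- **Theorem 2.6 (Theorem A).** Let $\pi$ be a set of primes, not the set of all primes, and let $\pi'$ be the complementary set of primes. For a positive integer $m$ write $m\in\pi'$ if all prime divisors of $m$ lie in $\pi'$, and let $\mathbb Z_\pi$ be the additive group of rational numbers whose (reduced) denominator lies in $\pi'$. A group $H$ is *$\pi$-local* if $x\mapsto x^q$ is a bijection of $H$ for every prime $q\notin\pi$. A *$\pi$-localization* of a group $G$ is a homomorphism $G\to G_\pi$ to a $\pi$-local group through which every homomorphism from $G$ to a $\pi$-local group factors uniquely. For $x\in G$ let $C_G(x)$ be its centralizer, $C_G(x)^g=g^{-1}C_G(x)g$, and $D_G(x)=\{g\in G\mid C_G(x)\cap C_G(x)^g\neq 1\}$. The group $G$ belongs to the class $\mathcal P_\pi$ if (i) $x\mapsto x^m$ is injective on $G$ for every $m\in\pi'$; and (ii) for every $x\in G$ that has no $m$-th root in $G$ for some $m\in\pi'$, the group $C_G(x)$ is torsion-free and either (a) $D_G(x)=C_G(x)$, or (b) $D_G(x)$ is a subgroup with $|D_G(x):C_G(x)|=2$ and $C_G(x)$ is isomorphic to a subgroup of $\mathbb Z_\pi$. Let $G\in\mathcal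 P_\pi$ be a soluble group which is not $\pi$-local and is not virtually nilpotent. Then $G_\pi$ is not soluble. -/

import Mathlib

universe u

/-- `m ∈ π'`: `m` is a positive integer none of whose prime divisors lies in `π`. -/
def IsPrimeToSet (π : Set Nat.Primes) (m : ℕ) : Prop :=
  0 < m ∧ ∀ q : Nat.Primes, (q : ℕ) ∣ m → q ∉ π

/-- `G` is `π`-local: `x ↦ x ^ q` is bijective for every prime `q ∉ π`. -/
def IsPiLocal (π : Set Nat.Primes) (G : Type u) [Group G] : Prop :=
  ∀ q : Nat.Primes, q ∉ π → Function.Bijective (fun x : G => x ^ (q : ℕ))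

/-- `φ : G → L` is a `π`-localization of `G` (so `L` is `G_π`): `L` is `π`-local, and every
homomorphism from `G` to a `π`-local group factors uniquely through `φ`. -/
structure IsPiLocalization (π : Set Nat.Primes) {G L : Type u} [Group G] [Group L]
    (φ : G →* L) : Prop where
  isPiLocal : IsPiLocal π L
  existsUnique_lift : ∀ (H : Type u) [Group H], IsPiLocal π H →
    ∀ θ : G →* H, ∃! ψ : L →* H, ψ.comp φ = θ

/-- `G` is a `U_π`-group: `x ↦ x ^ m` is injective whenever `m ∈ π'`. -/
def IsUPi (π : Set Nat.Primes) (G : Type u) [Group G] : Prop :=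
  ∀ m : ℕ, IsPrimeToSet π m → Function.Injective (fun x : G => x ^ m)

/-- `ℤ_π`, the additive group of the rationals whose denominator lies in `π'`. -/
def integersAt (π : Set Nat.Primes) : AddSubgroup ℚ where
  carrier := {r | IsPrimeToSet π r.den}
  zero_mem' := ⟨by simp, fun q hq => absurd (by simpa using hq) q.2.one_lt.ne'⟩
  add_mem' := by
    intro r s hr hs
    refine ⟨(r + s).den_pos, fun q hq => ?_⟩
    rcases (q.2.dvd_mul).1 (hq.trans (Rat.add_den_dvd r s)) with h | h
    · exact hr.2 q h
    · exact hs.2 q h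
  neg_mem' := by
    intro r hr
    simpa using hr

/-- `C_G(x)`. -/
def centralizerOf {G : Type u} [Group G] (x : G) : Subgroup G :=
  Subgroup.centralizer {x}

/-- The conjugate `C ^ g = g⁻¹ C g`. -/
def conjugateSubgroup {G : Type u} [Group G] (C : Subgroup G) (g : G) : Subgroup G :=
  C.map (MulAut.conj g⁻¹).toMonoidHom

/-- `D_G(x) = {g ∈ G ∣ C_G(x) ∩ C_G(x) ^ g ≠ 1}`. -/
def conjMeetSet {G : Type u} [Group G] (x : G) : Set G :=
  {g | centralizerOf x ⊓ conjugateSubgroup (centralizerOf x) g ≠ ⊥}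

/-- The class `P_π`. In the last clause, `|D_G(x) : C_G(x)| = 2` means that the set `D_G(x)` is a
subgroup of `G` in which `C_G(x)` has index `2`, and `C_G(x) ≤ ℤ_π` means that `C_G(x)` embeds in
`ℤ_π`. -/
structure IsPPi (π : Set Nat.Primes) (G : Type u) [Group G] : Prop where
  isUPi : IsUPi π G
  centralizer_cond : ∀ x : G, (∃ m : ℕ, IsPrimeToSet π m ∧ ∀ y : G, y ^ m ≠ x) →
    (∀ c ∈ centralizerOf x, c ≠ 1 → ¬ IsOfFinOrder c) ∧
    (conjMeetSet x = (centralizerOf x : Set G) ∨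
      ((∃ D : Subgroup G, (D : Set G) = conjMeetSet x ∧ centralizerOf x ≤ D ∧
          (centralizerOf x).relIndex D = 2) ∧
        ∃ f : centralizerOf x →* Multiplicative (integersAt π), Function.Injective f))

/-! Every group has a `π`-localization (in the same universe): formal group words with formal
roots, two of them being identified when they agree in every `π`-local group. -/

/-- Formal words in the elements of `G`, the group operations and `q`-th roots, `q ∉ π`. -/
inductive RootWord (π : Set Nat.Primes) (G : Type u) : Type u
  | of (g : G) : RootWord π G
  | one : RootWord π G
  | mul (a b : RootWord π G) : RootWord π G
  | inv (a : RootWord π G) : RootWord π G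
  | root (q : Nat.Primes) (hq : q ∉ π) (a : RootWord π G) : RootWord π G

/-- The value of a formal word in a `π`-local group. -/
noncomputable def RootWord.eval {π : Set Nat.Primes} {G H : Type u} [Group G] [Group H]
    (hH : IsPiLocal π H) (θ : G →* H) : RootWord π G → H
  | .of g => θ g
  | .one => 1
  | .mul a b => a.eval hH θ * b.eval hH θ
  | .inv a => (a.eval hH θ)⁻¹
  | .root q hq a => Classical.choose ((hH q hq).2 (a.eval hH θ))

theorem RootWord.eval_root_pow {π : Set Nat.Primes} {G H : Type u} [Group G] [Group H]
    (hH : IsPiLocal π H) (θ : G →* H) (q : Nat.Primes) (hq : q ∉ π) (a : RootWord π G) :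
    (RootWord.root q hq a).eval hH θ ^ (q : ℕ) = a.eval hH θ :=
  Classical.choose_spec ((hH q hq).2 (a.eval hH θ))

/-- Equality of words in all `π`-local groups. -/
def RootWord.setoid (π : Set Nat.Primes) (G : Type u) [Group G] : Setoid (RootWord π G) where
  r a b := ∀ (H : Type u) [Group H] (hH : IsPiLocal π H) (θ : G →* H), a.eval hH θ = b.eval hH θ
  iseqv := ⟨fun _ _ _ _ _ => rfl, fun h H _ hH θ => (h H hH θ).symm,
    fun h h' H _ hH θ => (h H hH θ).trans (h' H hH θ)⟩

/-- A concrete model of `G_π`. -/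
def PiLocalizationModel (π : Set Nat.Primes) (G : Type u) [Group G] : Type u :=
  Quotient (RootWord.setoid π G)

/-- The class of a formal word. -/
def PiLocalizationModel.mk {π : Set Nat.Primes} {G : Type u} [Group G] (a : RootWord π G) :
    PiLocalizationModel π G :=
  Quotient.mk _ a

instance (π : Set Nat.Primes) (G : Type u) [Group G] : Group (PiLocalizationModel π G) where
  mul := Quotient.map₂ RootWord.mul (fun _ _ h _ _ h' H _ hH θ =>
    congrArg₂ (· * ·) (h H hH θ) (h' H hH θ))
  one := Quotient.mk _ RootWord.one
  inv := Quotient.map RootWord.inv (fun _ _ h H _ hH θ => congrArg (·⁻¹) (h H hH θ))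
  mul_assoc a b c := Quotient.inductionOn₃ a b c fun _ _ _ =>
    Quotient.sound fun _ _ _ _ => mul_assoc _ _ _
  one_mul a := Quotient.inductionOn a fun _ => Quotient.sound fun _ _ _ _ => one_mul _
  mul_one a := Quotient.inductionOn a fun _ => Quotient.sound fun _ _ _ _ => mul_one _
  inv_mul_cancel a := Quotient.inductionOn a fun _ =>
    Quotient.sound fun _ _ _ _ => inv_mul_cancel _

theorem exists_isPiLocalization (π : Set Nat.Primes) (G : Type u) [Group G] :
    ∃ φ : G →* PiLocalizationModel π G, IsPiLocalization π φ := by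
  let ev : ∀ (H : Type u) [Group H], IsPiLocal π H → (G →* H) → (PiLocalizationModel π G →* H) :=
    fun H _ hH θ =>
      { toFun := Quotient.lift (fun a => a.eval hH θ) (fun _ _ h => h H hH θ)
        map_one' := rfl
        map_mul' := fun a b => Quotient.inductionOn₂ a b fun _ _ => rfl }
  have ext : ∀ a b : PiLocalizationModel π G,
      (∀ (H : Type u) [Group H] (hH : IsPiLocal π H) (θ : G →* H), ev H hH θ a = ev H hH θ b) →
      a = b := fun a b => Quotient.inductionOn₂ a b fun _ _ h => Quotient.sound h
  let φ : G →* PiLocalizationModel π G :=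
    { toFun := fun g => PiLocalizationModel.mk (RootWord.of g)
      map_one' := Quotient.sound fun _ _ _ θ => map_one θ
      map_mul' := fun a b => Quotient.sound fun _ _ _ θ => map_mul θ a b }
  have root_pow : ∀ (q : Nat.Primes) (hq : q ∉ π) (a : RootWord π G),
      PiLocalizationModel.mk (RootWord.root q hq a) ^ (q : ℕ) =
        PiLocalizationModel.mk a := by
    intro q hq a
    refine ext _ _ fun H _ hH θ => ?_
    rw [map_pow]
    exact RootWord.eval_root_pow hH θ q hq a
  refine ⟨φ, ⟨fun q hq => ⟨fun a b hab => ?_, fun a => ?_⟩, fun H _ hH θ => ?_⟩⟩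
  · refine ext _ _ fun H _ hH θ => (hH q hq).1 ?_
    simpa only [map_pow] using congrArg (ev H hH θ) hab
  · exact Quotient.inductionOn a fun w => ⟨_, root_pow q hq w⟩
  · have key : ∀ ψ : PiLocalizationModel π G →* H, ψ.comp φ = θ → ∀ w : RootWord π G,
        ψ (PiLocalizationModel.mk w) = ev H hH θ (PiLocalizationModel.mk w) := by
      intro ψ hψ w
      induction w with
      | of g => exact DFunLike.congr_fun hψ g
      | one => exact (map_one ψ).trans (map_one (ev H hH θ)).symm
      | mul a b iha ihb =>
        have h : (PiLocalizationModel.mk (a.mul b) : PiLocalizationModel π G) =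
            PiLocalizationModel.mk a * PiLocalizationModel.mk b := rfl
        rw [h, map_mul, map_mul, iha, ihb]
      | inv a iha =>
        have h : (PiLocalizationModel.mk a.inv : PiLocalizationModel π G) =
            (PiLocalizationModel.mk a)⁻¹ := rfl
        rw [h, map_inv, map_inv, iha]
      | root q hq a iha =>
        refine (hH q hq).1 ?_
        change ψ _ ^ (q : ℕ) = (ev H hH θ) _ ^ (q : ℕ)
        rw [← map_pow, ← map_pow, root_pow, iha]
    exact ⟨ev H hH θ, rfl, fun ψ hψ => MonoidHom.ext fun a => Quotient.inductionOn a (key ψ hψ)⟩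

/-! Some `x` in `G` lacks an `m`-th root with `m` in `π'`. The class `P_π` yields a more flexible
condition (`IsPPi.isRootTame`): at such `x` the centralizer `C` is torsion-free, and any element
conjugating a nontrivial element of `C` into `C` acts on all of `C` as the identity or as inversion.
So `C` is abelian, and the subgroup `D` of elements acting by sign is `C`, or contains it with index
2 and consists of involutions outside it. Such a `D` embeds in a `π`-local group `D'` of the same
shape (`exists_dihedral_localization`).

Let `Γ` be the amalgam of `G` and `D'` over `D`. On its Bass–Serre tree only `1` fixes two vertices
at distance at least 3. Elements without fixed vertices then have an axis that governs their
centralizers, while elements fixing a vertex are handled inside the factors. Hence `Γ` satisfies the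
same condition again (`IsRootTame.exists_extension`). As roots can be adjoined repeatedly, a reduced
product argument embeds `Γ` in a `π`-local group `L` (`IsRootTame.exists_isPiLocal`).

The map from `G` to `L` factors through `G_π`, and the image of `G_π` contains `Γ`, because `Γ` is
generated by `G` and roots of elements of `G`. If `G_π` is soluble, so is `Γ`. A soluble group
acting in this way fixes a vertex or acts by sign on the centralizer of an element of infinite order
(`IsAcylindrical.fixes_or_actsBySign`). A fixed vertex of type `G` is impossible, since `x` gains a
root in `Γ`; in the remaining cases `G` has an abelian subgroup of index at most 2, so it is
virtually nilpotent. -/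

/-! ### Tree metrics, lines and axes of acylindrical actions. -/

/-- An integer-valued tree metric: `0`-hyperbolic and with the interval property. -/
structure IsTreeMetric {V : Type*} (d : V → V → ℕ) : Prop where
  self : ∀ x, d x x = 0
  eq_of_zero : ∀ x y, d x y = 0 → x = y
  symm : ∀ x y, d x y = d y x
  four_point : ∀ x y z w, d x y + d z w ≤ d x z + d y w ∨ d x y + d z w ≤ d x w + d y z
  between : ∀ x y i, i ≤ d x y → ∃ z, d x z = i ∧ i + d z y = d x y

/-- An action on a tree, without inversions, in which only `1` fixes two vertices at distance
at least `3`. -/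
structure IsAcylindrical (Γ : Type*) {V : Type*} [Group Γ] [MulAction Γ V] (d : V → V → ℕ) : Prop
    extends IsTreeMetric d where
  smul : ∀ (g : Γ) x y, d (g • x) (g • y) = d x y
  even : ∀ (g : Γ) x, Even (d x (g • x))
  eq_one : ∀ (g : Γ) p q, 3 ≤ d p q → g • p = p → g • q = q → g = 1

/-- A bi-infinite geodesic. -/
def IsLine {V : Type*} (d : V → V → ℕ) (l : ℤ → V) : Prop :=
  ∀ i j, d (l i) (l j) = (i - j).natAbs

namespace IsTreeMetric

variable {V : Type*} {d : V → V → ℕ}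

theorem triangle (h : IsTreeMetric d) (x y z : V) : d x y ≤ d x z + d z y := by
  have h1 := h.four_point x y z z
  have h2 := h.self z
  have h3 := h.symm y z
  omega

theorem eq_of_dist_eq (h : IsTreeMetric d) {p q v w : V} (hv : d p v + d v q = d p q)
    (h1 : d p w = d p v) (h2 : d w q = d v q) : w = v := by
  have h3 := h.four_point w v p q
  rw [h.symm w p, h.symm v p] at h3
  exact h.eq_of_zero _ _ (by omega)

/-- If two points of `F` are at distance 2, their midpoint is the same for every such pair.
Otherwise distances in `F` are at most 1, and even displacement forces each point of `F` to be
fixed. -/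
theorem exists_center (h : IsTreeMetric d) {F : Set V} (hF : F.Nonempty)
    (hdiam : ∀ p ∈ F, ∀ q ∈ F, d p q ≤ 2) :
    ∃ v, ∀ f : V → V, (∀ x y, d (f x) (f y) = d x y) → (∀ x, Even (d x (f x))) →
      (∀ p ∈ F, f p ∈ F) → f v = v := by
  by_cases hc : ∃ p ∈ F, ∃ q ∈ F, d p q = 2
  · obtain ⟨p, hp, q, hq, hpq⟩ := hc
    obtain ⟨m, hm1, hm2⟩ := h.between p q 1 (by omega)
    refine ⟨m, fun f hf _ hFf => ?_⟩
    have a1 := hdiam _ (hFf p hp) _ hp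
    have a2 := hdiam _ (hFf p hp) _ hq
    have a3 := hdiam _ (hFf q hq) _ hp
    have a4 := hdiam _ (hFf q hq) _ hq
    have b1 := hf p q
    have b2 := hf p m
    have b3 := hf m q
    have c1 := h.four_point m (f p) p q
    have c2 := h.four_point m (f q) p q
    have c3 := h.four_point (f m) m (f p) (f q)
    rw [h.symm m p] at c1 c2
    rw [h.symm (f m) (f p)] at c3
    exact h.eq_of_zero _ _ (by omega)
  · push Not at hc
    obtain ⟨p, hp⟩ := hF
    refine ⟨p, fun f _ hev hFf => ?_⟩
    have a1 := hdiam _ hp _ (hFf p hp)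
    have a2 := hc _ hp _ (hFf p hp)
    obtain ⟨k, hk⟩ := hev p
    exact (h.eq_of_zero _ _ (by omega)).symm

end IsTreeMetric

namespace IsLine

variable {V : Type*} {d : V → V → ℕ} {l l' : ℤ → V}

theorem reverse (hl : IsLine d l) : IsLine d (fun i => l (-i)) := by
  intro i j
  have := hl (-i) (-j)
  simp only [this]
  omega

/-- In a tree, long geodesics with nearby ends share their middle parts. A point at distances `N +
x` and `N - x` from `l (-N)` and `l N` must be `l x`, which is how points of `l'` are located on
`l`. -/
theorem eq_shift (h : IsTreeMetric d) (hl : IsLine d l) (hl' : IsLine d l') (B : ℕ)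
    (hB : ∀ n : ℕ, ∃ N : ℕ, n ≤ N ∧ d (l N) (l' N) ≤ B ∧ d (l (-N)) (l' (-N)) ≤ B) :
    ∃ k, ∀ i, l' i = l (i + k) := by
  have key : ∀ (q : V) (N : ℕ) (x : ℤ), (d q (l (-N)) : ℤ) = N + x → (d q (l N) : ℤ) = N - x →
      q = l x := by
    intro q N x h1 h2
    have := h.four_point q (l x) (l (-N)) (l N)
    have e1 : d (l x) (l (-N)) = N + x := by rw [hl]; omega
    have e2 : d (l x) (l N) = N - x := by rw [hl]; omega
    have e3 : d (l (-N)) (l N) = 2 * N := by rw [hl]; omega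
    exact h.eq_of_zero _ _ (by omega)
  obtain ⟨k, hk⟩ : ∃ k, l' 0 = l k := by
    obtain ⟨N, hN, h1, h2⟩ := hB (B + 1)
    have a1 : d (l' 0) (l' (-N)) = N := by rw [hl']; omega
    have a2 : d (l' 0) (l' N) = N := by rw [hl']; omega
    have a3 : d (l' (-N)) (l' N) = 2 * N := by rw [hl']; omega
    have a4 : d (l (-N)) (l N) = 2 * N := by rw [hl]; omega
    have f1 := h.four_point (l' 0) (l (-N)) (l' (-N)) (l' N)
    have f2 := h.four_point (l (-N)) (l' N) (l' 0) (l N)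
    have t := h.triangle (l (-N)) (l N) (l' 0)
    rw [h.symm (l (-N)) (l' 0)] at f2 t
    rw [h.symm (l' N) (l N), h.symm (l' N) (l' 0)] at f2
    refine ⟨d (l' 0) (l (-N)) - N, key _ N _ (by omega) (by omega)⟩
  refine ⟨k, fun i => ?_⟩
  obtain ⟨N, hN, h1, h2⟩ := hB (B + 2 * i.natAbs + k.natAbs + 1)
  have a1 : d (l' 0) (l' (-N)) = N := by rw [hl']; omega
  have a2 : d (l' 0) (l' N) = N := by rw [hl']; omega
  have a3 : (d (l' i) (l' (-N)) : ℤ) = N + i := by rw [hl']; omega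
  have a4 : (d (l' i) (l' N) : ℤ) = N - i := by rw [hl']; omega
  have a5 : d (l' i) (l' 0) = i.natAbs := by rw [hl']; omega
  have a6 : (d (l' 0) (l (-N)) : ℤ) = N + k := by rw [hk, hl]; omega
  have a7 : (d (l' 0) (l N) : ℤ) = N - k := by rw [hk, hl]; omega
  have f1 := h.four_point (l' i) (l (-N)) (l' 0) (l' (-N))
  have f2 := h.four_point (l' i) (l' (-N)) (l' 0) (l (-N))
  have f3 := h.four_point (l' i) (l N) (l' 0) (l' N)
  have f4 := h.four_point (l' i) (l' N) (l' 0) (l N)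
  rw [h.symm (l (-N)) (l' 0)] at f1
  rw [h.symm (l' (-N)) (l' 0), h.symm (l' (-N)) (l (-N))] at f2
  rw [h.symm (l N) (l' 0)] at f3
  rw [h.symm (l' N) (l' 0), h.symm (l' N) (l N)] at f4
  refine key _ N _ ?_ ?_
  · clear f3 f4; omega
  · clear f1 f2; omega

end IsLine

/-- `z` translates the line `l` by `s`. -/
def Translates {Γ V : Type*} [Group Γ] [MulAction Γ V] (z : Γ) (l : ℤ → V) (s : ℤ) : Prop :=
  ∀ i, z • l i = l (i + s)

namespace Translates

variable {Γ V : Type*} [Group Γ] [MulAction Γ V] {l : ℤ → V} {z w : Γ} {s t : ℤ}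

theorem one : Translates (1 : Γ) l 0 := fun i => by simp

theorem mul (hz : Translates z l s) (hw : Translates w l t) : Translates (z * w) l (s + t) :=
  fun i => by rw [mul_smul, hw, hz]; congr 1; ring

theorem inv (hz : Translates z l s) : Translates z⁻¹ l (-s) := fun i => by
  rw [inv_smul_eq_iff, hz]; congr 1; ring

theorem pow (hz : Translates z l s) (n : ℕ) : Translates (z ^ n) l (n * s) := by
  induction n with
  | zero => simpa using one
  | succ n ih =>
    rw [pow_succ, Nat.cast_succ, add_mul, one_mul]
    exact ih.mul hz

theorem conj (hz : Translates z l s) (g : Γ) :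
    Translates (g * z * g⁻¹) (fun i => g • l i) s := fun i => by
  simp only [mul_smul, inv_smul_smul, hz i]

theorem reverse (hz : Translates z l s) : Translates z (fun i => l (-i)) (-s) := fun i => by
  rw [hz]; congr 1; ring

end Translates

namespace IsAcylindrical

variable {Γ V : Type*} [Group Γ] [MulAction Γ V] {d : V → V → ℕ} {l l' : ℤ → V} {z w : Γ} {s t : ℤ}

theorem smul_eq_of_between (h : IsAcylindrical Γ d) {p q v : V} (hp : z • p = p) (hq : z • q = q)
    (hv : d p v + d v q = d p q) : z • v = v := by
  have h1 := h.smul z p v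
  have h2 := h.smul z v q
  rw [hp] at h1
  rw [hq] at h2
  exact h.eq_of_dist_eq hv h1 h2

theorem isLine_smul (h : IsAcylindrical Γ d) (g : Γ) (hl : IsLine d l) :
    IsLine d (fun i => g • l i) := fun i j => by
  rw [h.smul, hl]

/-- Displacements under `z ^ n` grow at least at the rate `s.natAbs`. Taking `n` large shows that
`z` has no fixed vertex when `s ≠ 0`, and that the translation length does not depend on the line.
-/
theorem natAbs_le (h : IsAcylindrical Γ d) (hl : IsLine d l) (hz : Translates z l s) (p : V)
    (n : ℕ) : n * s.natAbs ≤ 2 * d (l 0) p + d p (z ^ n • p) := by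
  have h1 := hz.pow n 0
  have h2 := hl 0 (0 + n * s)
  rw [← h1] at h2
  have h3 := h.triangle (l 0) (z ^ n • l 0) p
  have h4 := h.triangle p (z ^ n • l 0) (z ^ n • p)
  rw [h.smul, h.symm p (l 0)] at h4
  have h5 : (0 - (0 + (n : ℤ) * s)).natAbs = n * s.natAbs := by
    rw [zero_add, zero_sub, Int.natAbs_neg, Int.natAbs_mul, Int.natAbs_natCast]
  omega

theorem smul_ne (h : IsAcylindrical Γ d) (hl : IsLine d l) (hz : Translates z l s) (hs : s ≠ 0)
    (p : V) : z • p ≠ p := fun hp => by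
  have h1 := h.natAbs_le hl hz p (2 * d (l 0) p + 1)
  have h2 : ∀ n : ℕ, z ^ n • p = p := fun n => by
    induction n with
    | zero => simp
    | succ n ih => rw [pow_succ, mul_smul, hp, ih]
  rw [h2, h.self] at h1
  have h3 : 1 ≤ s.natAbs := by omega
  nlinarith

theorem natAbs_eq (h : IsAcylindrical Γ d) (hl : IsLine d l) (hl' : IsLine d l')
    (hz : Translates z l s) (hz' : Translates z l' t) : s.natAbs = t.natAbs := by
  have aux : ∀ {l l' : ℤ → V} {s t : ℤ}, IsLine d l → IsLine d l' → Translates z l s →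
      Translates z l' t → s.natAbs ≤ t.natAbs := by
    intro l l' s t hl hl' hz hz'
    have h1 := h.natAbs_le hl hz (l' 0) (2 * d (l 0) (l' 0) + 1)
    rw [hz'.pow, hl', zero_add, zero_sub, Int.natAbs_neg, Int.natAbs_mul, Int.natAbs_natCast] at h1
    by_contra! hlt
    nlinarith
  exact le_antisymm (aux hl hl' hz hz') (aux hl' hl hz' hz)

/-- Powers of `z` move `l 0` and `l' 0` along both lines at constant mutual distance, so the lines
stay close at both ends and `IsLine.eq_shift` applies. -/
theorem exists_shift (h : IsAcylindrical Γ d) (hl : IsLine d l) (hl' : IsLine d l')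
    (hz : Translates z l s) (hz' : Translates z l' s) (hs : s ≠ 0) :
    ∃ k, ∀ i, l' i = l (i + k) := by
  have pos : ∀ {z : Γ} {s : ℤ}, Translates z l s → Translates z l' s → 0 < s →
      ∃ k, ∀ i, l' i = l (i + k) := by
    intro z s hz hz' hs
    refine hl.eq_shift h.toIsTreeMetric hl' (d (l 0) (l' 0)) fun n => ⟨n * s.toNat, ?_, ?_, ?_⟩
    · exact Nat.le_mul_of_pos_right n (by omega)
    · have e1 := hz.pow n 0
      have e2 := hz'.pow n 0
      rw [zero_add] at e1 e2
      rw [Nat.cast_mul, Int.toNat_of_nonneg hs.le, ← e1, ← e2, h.smul]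
    · have e1 := (hz.pow n).inv 0
      have e2 := (hz'.pow n).inv 0
      rw [zero_add] at e1 e2
      rw [Nat.cast_mul, Int.toNat_of_nonneg hs.le, ← e1, ← e2, h.smul]
  rcases lt_or_gt_of_ne hs with h1 | h1
  · exact pos hz.inv hz'.inv (by omega)
  · exact pos hz hz' h1

theorem eq_one_of_translates (h : IsAcylindrical Γ d) (hl : IsLine d l) (hz : Translates z l 0) :
    z = 1 := by
  refine h.eq_one z (l 0) (l 3) (by rw [hl]; decide) ?_ ?_ <;> rw [hz, add_zero]

theorem eq_of_translates (h : IsAcylindrical Γ d) (hl : IsLine d l) (hz : Translates z l s)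
    (hw : Translates w l s) : z = w := by
  have := h.eq_one_of_translates hl (z := z * w⁻¹) (by simpa using hz.mul hw.inv)
  rwa [mul_inv_eq_one] at this

/-- In a tree, a path without backtracking is geodesic: it suffices that the segments from `v` to `g
• v` and on to `g ^ 2 • v` do not overlap. -/
theorem dist_pow (h : IsAcylindrical Γ d) {g : Γ} {v : V} {τ : ℕ} (hτ : 0 < τ)
    (h1 : d v (g • v) = τ) (h2 : d v (g ^ 2 • v) = 2 * τ) (n : ℕ) :
    d v (g ^ n • v) = n * τ := by
  suffices H : d v (g ^ n • v) = n * τ ∧ d v (g ^ (n + 1) • v) = (n + 1) * τ from H.1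
  induction n with
  | zero => simp [h.self, h1]
  | succ n ih =>
    refine ⟨ih.2, ?_⟩
    rcases n with _ | n
    · simpa using h2
    · obtain ⟨ih1, ih2⟩ := ih
      have f := h.four_point v (g ^ (n + 1 + 1) • v) (g • v) (g ^ (n + 1 + 1 + 1) • v)
      have t := h.triangle v (g ^ (n + 1 + 1 + 1) • v) (g • v)
      rw [show g • v = g ^ 1 • v by rw [pow_one]] at *
      have e1 : d (g ^ 1 • v) (g ^ (n + 1 + 1 + 1) • v) = (n + 1 + 1) * τ := by
        rw [show g ^ (n + 1 + 1 + 1) = g ^ 1 * g ^ (n + 1 + 1) by rw [← pow_add]; congr 1; ring,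
          mul_smul, h.smul, ih2]
      have e2 : d (g ^ (n + 1 + 1) • v) (g ^ (n + 1 + 1 + 1) • v) = τ := by
        rw [pow_succ g (n + 1 + 1), mul_smul, h.smul, ← h1, pow_one]
      have e3 : d (g ^ (n + 1 + 1) • v) (g ^ 1 • v) = (n + 1) * τ := by
        rw [h.symm, show g ^ (n + 1 + 1) = g ^ 1 * g ^ (n + 1) by rw [← pow_add]; congr 1; ring,
          mul_smul, h.smul, ih1]
      rw [e1, e2, e3, h1, ih2] at f
      rw [e1, h1] at t
      rcases f with f | f <;> nlinarith

/-- A vertex of minimal displacement works. If the two segments at `g • v` overlapped, parity would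
make the overlap at least one edge, and the neighbour `u` of `v` towards `g • v` would have
displacement smaller by 2. -/
theorem exists_dist_sq (h : IsAcylindrical Γ d) {g : Γ} [Nonempty V] (hg : ∀ v : V, g • v ≠ v) :
    ∃ v, 0 < d v (g • v) ∧ d v (g ^ 2 • v) = 2 * d v (g • v) := by
  classical
  have hex : ∃ n, ∃ v, d v (g • v) = n := ⟨_, Classical.arbitrary V, rfl⟩
  obtain ⟨v, hv⟩ := Nat.find_spec hex
  have hmin : ∀ u, d v (g • v) ≤ d u (g • u) := fun u => by
    rw [hv]; exact Nat.find_min' hex ⟨u, rfl⟩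
  have hpos : 0 < d v (g • v) := Nat.pos_of_ne_zero fun h0 => hg v (h.eq_of_zero _ _ h0).symm
  refine ⟨v, hpos, ?_⟩
  obtain ⟨a, ha⟩ := h.even g v
  obtain ⟨b, hb⟩ := h.even (g ^ 2) v
  by_contra hne
  have hgg : d (g • v) (g ^ 2 • v) = d v (g • v) := by rw [pow_two, mul_smul, h.smul]
  have t := h.triangle v (g ^ 2 • v) (g • v)
  obtain ⟨u, hu1, hu2⟩ := h.between v (g • v) 1 (by omega)
  obtain ⟨m, hm1, hm2⟩ := h.between u (g • v) (d v (g • v) - 2) (by omega)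
  have k1 : d (g • v) (g • u) = 1 := by rw [h.smul, hu1]
  have k2 : d (g • u) (g ^ 2 • v) + 1 = d v (g • v) := by
    rw [pow_two, mul_smul, h.smul]; omega
  have t1 := h.triangle v m u
  have t2 := h.triangle v (g • v) m
  have f1 := h.four_point m (g ^ 2 • v) v (g • v)
  have f2 := h.four_point m (g • u) (g • v) (g ^ 2 • v)
  have t3 := hmin u
  rw [h.symm m v, h.symm (g ^ 2 • v) (g • v), h.symm (g ^ 2 • v) v] at f1
  rw [h.symm (g • u) (g • v)] at f2
  have hmg : m = g • u := h.eq_of_zero _ _ (by omega)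
  rw [hmg] at hm1
  omega

theorem exists_line (h : IsAcylindrical Γ d) {g : Γ} [Nonempty V] (hg : ∀ v : V, g • v ≠ v) :
    ∃ l, IsLine d l ∧ ∃ s, 0 < s ∧ Translates g l s := by
  obtain ⟨v, hpos, hsq⟩ := h.exists_dist_sq hg
  set τ := d v (g • v) with hτ
  have hd := h.dist_pow hpos hτ.symm hsq
  -- The point at distance `r` on the segment from `v` to `g • v`; outside the range the value is
  -- irrelevant. The axis is the union of the translates of this segment.
  have hz : ∀ r : ℤ, ∃ z, 0 ≤ r → r ≤ τ → (d v z : ℤ) = r ∧ (d z (g • v) : ℤ) = τ - r := by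
    intro r
    by_cases hr : 0 ≤ r ∧ r ≤ τ
    · obtain ⟨z, h1, h2⟩ := h.between v (g • v) r.toNat (by omega)
      exact ⟨z, fun _ _ => by omega⟩
    · exact ⟨v, fun h1 h2 => absurd ⟨h1, h2⟩ hr⟩
  choose z hz using hz
  have hτ0 : (0 : ℤ) < τ := by exact_mod_cast hpos
  have hzr : ∀ i : ℤ, (d v (z (i % τ)) : ℤ) = i % τ ∧ (d (z (i % τ)) (g • v) : ℤ) = τ - i % τ :=
    fun i => hz _ (Int.emod_nonneg _ hτ0.ne') (Int.emod_lt_of_pos _ hτ0).le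
  have main : ∀ r s : ℤ, ∀ n : ℕ, 0 ≤ r → r < τ → 0 ≤ s → s < τ →
      (d (z r) (g ^ n • z s) : ℤ) = |n * τ + s - r| := by
    intro r s n hr hr' hs hs'
    obtain ⟨a1, a2⟩ := hz r hr hr'.le
    obtain ⟨b1, b2⟩ := hz s hs hs'.le
    rcases n with _ | n
    · have f := h.four_point (z r) (z s) v (g • v)
      have t1 := h.triangle (z r) (g • v) (z s)
      have t2 := h.triangle (z s) (g • v) (z r)
      rw [h.symm (z r) v, h.symm (z s) v] at f
      rw [h.symm (z s) (z r)] at t2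
      rw [pow_zero, one_smul, Nat.cast_zero, zero_mul, zero_add]
      rcases abs_cases (s - r) with ⟨e, _⟩ | ⟨e, _⟩ <;> rw [e] <;> omega
    · have e1 := hd (n + 1 + 1)
      have e2 := hd n
      have t1 := h.triangle v (g ^ (n + 1 + 1) • v) (z r)
      have t2 := h.triangle (z r) (g ^ (n + 1 + 1) • v) (g ^ (n + 1) • z s)
      have t3 := h.triangle (z r) (g ^ (n + 1) • z s) (g • v)
      have t4 := h.triangle (g • v) (g ^ (n + 1) • z s) (g ^ (n + 1) • v)
      have e3 : d (g ^ (n + 1) • z s) (g ^ (n + 1 + 1) • v) = d (z s) (g • v) := by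
        rw [pow_succ g (n + 1), mul_smul, h.smul]
      have e4 : d (g ^ (n + 1) • v) (g ^ (n + 1) • z s) = d v (z s) := h.smul _ _ _
      have e5 : d (g • v) (g ^ (n + 1) • v) = n * τ := by
        rw [pow_succ', mul_smul, h.smul, e2]
      have e6 : ((n + 1 : ℕ) : ℤ) * τ = n * τ + τ := by push_cast; ring
      have e7 : (n + 1 + 1) * τ = n * τ + τ + τ := by ring
      have e8 : ((n * τ : ℕ) : ℤ) = n * τ := by push_cast; ring
      have e9 : (0 : ℤ) ≤ n * τ := by positivity
      rw [abs_of_nonneg (by omega)]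
      omega
  refine ⟨fun i => g ^ (i / τ) • z (i % τ), ?_, τ, hτ0, ?_⟩
  · have le : ∀ i j : ℤ, i / τ ≤ j / τ →
        d (g ^ (i / τ) • z (i % τ)) (g ^ (j / τ) • z (j % τ)) = (i - j).natAbs := by
      intro i j hij
      obtain ⟨n, hn⟩ := Int.eq_ofNat_of_zero_le (sub_nonneg.2 hij)
      rw [show j / τ = i / τ + n by omega, zpow_add, mul_smul, h.smul, zpow_natCast]
      have := main (i % τ) (j % τ) n (Int.emod_nonneg _ hτ0.ne') (Int.emod_lt_of_pos _ hτ0)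
        (Int.emod_nonneg _ hτ0.ne') (Int.emod_lt_of_pos _ hτ0)
      have q1 := Int.mul_ediv_add_emod i τ
      have q2 := Int.mul_ediv_add_emod j τ
      have q3 : (n : ℤ) * τ + j % τ - i % τ = j - i := by
        rw [← hn]; linear_combination q2 - q1
      rw [q3, abs_sub_comm, ← Int.natCast_natAbs] at this
      exact_mod_cast this
    intro i j
    rcases le_total (i / τ) (j / τ) with hij | hij
    · exact le i j hij
    · rw [h.symm]
      have := le j i hij
      simp only [this]; omega
  · intro i
    simp only
    rw [Int.add_emod_right, Int.add_ediv_of_dvd_right (dvd_refl _), Int.ediv_self hτ0.ne',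
      add_comm (i / τ), zpow_one_add, mul_smul]

end IsAcylindrical

/-! ### Action by sign and tameness. -/

/-- Conjugation by `g` is the identity or the inversion on the centralizer of `x`. -/
def ActsBySign {G : Type*} [Group G] (g x : G) : Prop :=
  (∀ a, Commute a x → g * a * g⁻¹ = a) ∨ (∀ a, Commute a x → g * a * g⁻¹ = a⁻¹)

/-- Some root of `x` of order prime to `π` is missing. -/
def LacksRoot (π : Set Nat.Primes) {G : Type*} [Group G] (x : G) : Prop :=
  ∃ m : ℕ, IsPrimeToSet π m ∧ ∀ y : G, y ^ m ≠ x

/-- The centralizer of `x` is torsion-free, and whatever conjugates one of its nontrivial elements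
into it acts on it by sign. -/
structure IsTameAt {G : Type*} [Group G] (x : G) : Prop where
  torsionFree : ∀ c, Commute c x → c ≠ 1 → ¬ IsOfFinOrder c
  actsBySign : ∀ g c, Commute c x → c ≠ 1 → Commute (g * c * g⁻¹) x → ActsBySign g x

/-- A variant of the class `P_π`, stable under adjunction of roots. -/
structure IsRootTame (π : Set Nat.Primes) (G : Type*) [Group G] : Prop where
  isUPi : IsUPi π G
  isTameAt : ∀ x : G, LacksRoot π x → IsTameAt x

/-! ### Centralizers, roots and soluble groups in acylindrical actions. -/

namespace IsAcylindrical

variable {Γ V : Type*} [Group Γ] [MulAction Γ V] {d : V → V → ℕ} {y : Γ} {l : ℤ → V} {s : ℤ}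

/-- The image under `c` of the axis of `y` is an axis of `c * y * c⁻¹ = y`, hence the same line up
to a shift. -/
theorem translates_of_commute (h : IsAcylindrical Γ d) (hl : IsLine d l) (hy : Translates y l s)
    (hs : s ≠ 0) {c : Γ} (hc : Commute c y) : ∃ k, Translates c l k := by
  have h1 := hy.conj c
  rw [hc.eq, mul_inv_cancel_right] at h1
  exact h.exists_shift hl (h.isLine_smul c hl) hy h1 hs

theorem not_isOfFinOrder (h : IsAcylindrical Γ d) [Nonempty V] (hy : ∀ v : V, y • v ≠ v) {c : Γ}
    (hc : Commute c y) (h1 : c ≠ 1) : ¬ IsOfFinOrder c := by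
  obtain ⟨l, hl, s, hs, hy⟩ := h.exists_line hy
  obtain ⟨k, hk⟩ := h.translates_of_commute hl hy hs.ne' hc
  intro hfin
  obtain ⟨n, hn, hcn⟩ := isOfFinOrder_iff_pow_eq_one.1 hfin
  by_cases hk0 : k = 0
  · exact h1 (h.eq_one_of_translates hl (hk0 ▸ hk))
  · have h2 := hk.pow n
    rw [hcn] at h2
    exact h.smul_ne hl h2 (mul_ne_zero (by omega) hk0) (l 0) (one_smul _ _)

/-- Both `c` and its conjugate by `g` translate the axis of `y`, so `g` preserves this axis.
Conjugation by `g` keeps or negates translation amounts according to orientation, and an element is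
determined by its translation amount. -/
theorem actsBySign (h : IsAcylindrical Γ d) [Nonempty V] (hy : ∀ v : V, y • v ≠ v) {g c : Γ}
    (hc : Commute c y) (h1 : c ≠ 1) (hgc : Commute (g * c * g⁻¹) y) : ActsBySign g y := by
  obtain ⟨l, hl, s, hs, hy⟩ := h.exists_line hy
  have tr := fun {a : Γ} (ha : Commute a y) => h.translates_of_commute hl hy hs.ne' ha
  obtain ⟨k, hk⟩ := tr hc
  obtain ⟨k', hk'⟩ := tr hgc
  have hk0 : k ≠ 0 := fun h0 => h1 (h.eq_one_of_translates hl (h0 ▸ hk))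
  have hgl := h.isLine_smul g hl
  have hkg := hk.conj g
  rcases Int.natAbs_eq_natAbs_iff.1 (h.natAbs_eq hl hgl hk' hkg) with e | e
  · obtain ⟨j, hj⟩ := h.exists_shift hl hgl hk' (e ▸ hkg) (e ▸ hk0)
    refine Or.inl fun a ha => ?_
    obtain ⟨t, ht⟩ := tr ha
    have h2 : Translates (g * a * g⁻¹) (fun i => g • l i) t := ht.conj g
    refine h.eq_of_translates hl (s := t) (fun i => ?_) ht
    have h3 := h2 (i - j)
    simp only [hj] at h3
    rw [sub_add_cancel] at h3
    rw [h3]; congr 1; ring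
  · have hlr := hl.reverse
    have hr := hk'.reverse
    rw [e, neg_neg] at hr
    obtain ⟨j, hj⟩ := h.exists_shift hlr hgl hr hkg hk0
    refine Or.inr fun a ha => ?_
    obtain ⟨t, ht⟩ := tr ha
    have h2 : Translates (g * a * g⁻¹) (fun i => g • l i) t := ht.conj g
    refine h.eq_of_translates hl (s := -t) (fun i => ?_) ht.inv
    have h3 := h2 (-i - j)
    simp only [hj] at h3
    rw [show -(-i - j + j) = i by ring] at h3
    rw [h3]; congr 1; ring

/-- A nontrivial element with a fixed vertex determines a vertex that is fixed by every element
preserving its fixed vertices. -/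
theorem exists_center_fixed (h : IsAcylindrical Γ d) {F : Set V} (hF : F.Nonempty) {z : Γ}
    (hz : z ≠ 1) (hzF : ∀ v ∈ F, z • v = v) :
    ∃ v : V, ∀ g : Γ, (∀ p ∈ F, g • p ∈ F) → g • v = v := by
  obtain ⟨v, hv⟩ := h.exists_center hF fun (p : V) hp q hq => by
    by_contra! hlt
    exact hz (h.eq_one z p q hlt (hzF p hp) (hzF q hq))
  exact ⟨v, fun g hg => hv (g • ·) (h.smul g) (h.even g) hg⟩

theorem exists_fixed_of_commute (h : IsAcylindrical Γ d) {z : Γ} (hz : z ≠ 1) {p : V}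
    (hp : z • p = p) : ∃ v : V, ∀ g : Γ, Commute g z → g • v = v := by
  obtain ⟨v, hv⟩ := h.exists_center_fixed (F := {v : V | z • v = v}) ⟨p, hp⟩ hz fun _ hv => hv
  refine ⟨v, fun g hg => hv g fun q hq => ?_⟩
  change z • g • q = g • q
  rw [smul_smul, ← hg.eq, mul_smul, hq]

theorem pow_smul_ne (h : IsAcylindrical Γ d) [Nonempty V] (hy : ∀ v : V, y • v ≠ v) {m : ℕ}
    (hm : 0 < m) (v : V) : y ^ m • v ≠ v := by
  obtain ⟨l, hl, s, hs, hy⟩ := h.exists_line hy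
  exact h.smul_ne hl (hy.pow m) (by positivity) v

theorem pow_smul_eq {v : V} (hv : y • v = v) (n : ℕ) : y ^ n • v = v := by
  induction n with
  | zero => simp
  | succ n ih => rw [pow_succ, mul_smul, hv, ih]

/-- Uniqueness of roots holds as soon as it holds in the stabilizers of vertices. -/
theorem pow_injective (h : IsAcylindrical Γ d) [Nonempty V] {m : ℕ} (hm : 0 < m)
    (hst : ∀ (v : V) (g k : Γ), g • v = v → k • v = v → g ^ m = k ^ m → g = k) :
    Function.Injective (fun x : Γ => x ^ m) := by
  intro g k hgk
  simp only at hgk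
  by_cases hg : ∃ v : V, g • v = v
  · obtain ⟨v, hv⟩ := hg
    obtain ⟨w, hw⟩ : ∃ w : V, k • w = w := by
      by_contra! hk
      exact h.pow_smul_ne hk hm v (hgk ▸ pow_smul_eq hv m)
    -- When the common power is trivial, `g` and `k` need not visibly share a fixed vertex, so each
    -- is compared with `1`. Otherwise both commute with a nontrivial element that fixes a vertex,
    -- hence fix its centre.
    by_cases h1 : g ^ m = 1
    · rw [hst v g 1 hv (one_smul _ _) (by rw [h1, one_pow]),
        hst w k 1 hw (one_smul _ _) (by rw [← hgk, h1, one_pow])]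
    · obtain ⟨u, hu⟩ := h.exists_fixed_of_commute h1 (pow_smul_eq hv m)
      exact hst u g k (hu g (Commute.self_pow g m)) (hu k (hgk ▸ Commute.self_pow k m)) hgk
  · push Not at hg
    have hk : ∀ v : V, k • v ≠ v := fun v hv =>
      h.pow_smul_ne hg hm v (hgk ▸ pow_smul_eq hv m)
    obtain ⟨l, hl, s, hs, hy⟩ := h.exists_line hg
    obtain ⟨l', hl', t, ht, hy'⟩ := h.exists_line hk
    have e1 := hy.pow m
    have e2 := hy'.pow m
    rw [hgk] at e1
    have e3 := h.natAbs_eq hl hl' e1 e2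
    rw [Int.natAbs_mul, Int.natAbs_mul, Nat.mul_right_inj (by omega)] at e3
    have e4 : t = s := by omega
    subst e4
    obtain ⟨j, hj⟩ := h.exists_shift hl hl' e1 e2 (by positivity)
    refine h.eq_of_translates hl hy fun i => ?_
    have h3 := hy' (i - j)
    rw [hj, hj, sub_add_cancel] at h3
    rw [h3]; congr 1; ring

/-- A soluble group with an acylindrical action on a tree fixes a vertex, or all its elements act
by sign on the centralizer of one without fixed vertices. -/
theorem fixes_or_actsBySign (h : IsAcylindrical Γ d) [Nonempty V] (hsol : Group.IsSolvable Γ) :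
    (∃ v : V, ∀ g : Γ, g • v = v) ∨ ∃ y : Γ, ¬ IsOfFinOrder y ∧
      ∀ g : Γ, ActsBySign g y := by
  classical
  have hex := (Group.isSolvable_def Γ).1 hsol
  obtain ⟨n, hn⟩ : ∃ n, Nat.find hex = n := ⟨_, rfl⟩
  rcases n with _ | n
  · have h0 := Nat.find_spec hex
    rw [hn, derivedSeries_zero] at h0
    refine Or.inl ⟨Classical.arbitrary V, fun g => ?_⟩
    have : g ∈ (⊤ : Subgroup Γ) := Subgroup.mem_top g
    rw [h0, Subgroup.mem_bot] at this
    rw [this, one_smul]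
  -- The last nontrivial term of the derived series: an abelian normal subgroup.
  set A := derivedSeries Γ n with hA
  have hA1 : A ≠ ⊥ := Nat.find_min hex (hn ▸ Nat.lt_succ_self n)
  have hAn : A.Normal := derivedSeries_normal Γ n
  have hAc : ∀ a ∈ A, ∀ b ∈ A, Commute a b := fun a ha b hb => by
    have h0 := Nat.find_spec hex
    rw [hn, derivedSeries_succ, Subgroup.commutator_eq_bot_iff_le_centralizer] at h0
    exact (Subgroup.mem_centralizer_iff.1 (h0 ha) b hb).symm
  obtain ⟨a, haA, ha1⟩ := A.bot_or_exists_ne_one.resolve_left hA1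
  by_cases hell : ∀ a ∈ A, ∃ v : V, a • v = v
  · left
    -- The centre attached to `a` is fixed by all of `A`, since `A` is abelian. The vertices fixed
    -- by `A` thus form a nonempty set of diameter at most 2, invariant under `Γ` by normality, and
    -- its centre is fixed by `Γ`.
    obtain ⟨p, hp⟩ := hell a haA
    obtain ⟨v, hv⟩ := h.exists_fixed_of_commute ha1 hp
    obtain ⟨w, hw⟩ := h.exists_center_fixed (F := {v : V | ∀ b ∈ A, b • v = v})
      ⟨v, fun b hb => hv b (hAc b hb a haA)⟩ ha1 fun v hv => hv a haA
    refine ⟨w, fun g => hw g fun q hq b hb => ?_⟩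
    have := hq (g⁻¹ * b * g⁻¹⁻¹) (hAn.conj_mem b hb g⁻¹)
    rw [inv_inv, mul_smul, mul_smul, inv_smul_eq_iff] at this
    exact this
  · right
    push Not at hell
    obtain ⟨y, hyA, hy⟩ := hell
    have hy1 : y ≠ 1 := fun h1 => hy (Classical.arbitrary V) (by rw [h1, one_smul])
    exact ⟨y, h.not_isOfFinOrder hy (Commute.refl y) hy1, fun g =>
      h.actsBySign hy (Commute.refl y) hy1 (hAc _ (hAn.conj_mem y hyA g) y hyA)⟩

end IsAcylindrical

theorem ActsBySign.commute {G : Type*} [Group G] {y c : G} (hc : ActsBySign c y)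
    (hcy : Commute c y) (hy : ¬ IsOfFinOrder y) {b : G} (hb : Commute b y) : Commute c b := by
  rcases hc with h | h
  · exact mul_inv_eq_iff_eq_mul.1 (h b hb)
  · refine absurd (isOfFinOrder_iff_pow_eq_one.2 ⟨2, two_pos, ?_⟩) hy
    have := h y (Commute.refl y)
    rw [hcy.eq, mul_inv_cancel_right] at this
    rw [pow_two]
    nth_rw 2 [this]
    exact mul_inv_cancel y

/-- If all elements of `Γ` act by sign on the centralizer of `y`, this centralizer is abelian of
index at most `2`. -/
theorem isVirtuallyNilpotent_of_actsBySign {G Γ : Type*} [Group G] [Group Γ] {ι : G →* Γ}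
    (hι : Function.Injective ι) {y : Γ} (hy : ¬ IsOfFinOrder y)
    (hs : ∀ g : G, ActsBySign (ι g) y) : Group.IsVirtuallyNilpotent G := by
  let S : Subgroup G := (Subgroup.centralizer {y}).comap ι
  have hS : ∀ g, g ∈ S ↔ Commute (ι g) y := fun g => by
    rw [Subgroup.mem_comap, Subgroup.mem_centralizer_singleton_iff]; exact Iff.rfl
  have neg : ∀ g, g ∉ S → ι g * y * (ι g)⁻¹ = y⁻¹ := fun g hg => by
    rcases hs g with h | h
    · exact absurd ((hS g).2 (mul_inv_eq_iff_eq_mul.1 (h y (Commute.refl y)))) hg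
    · exact h y (Commute.refl y)
  refine ⟨S, ?_, ?_⟩
  · let _ : CommGroup S := { (inferInstance : Group S) with
      mul_comm := fun a b => Subtype.ext (hι (by
        have ha := (hS _).1 a.2
        have hb := (hS _).1 b.2
        simpa using ((hs a).commute ha hy hb).eq)) }
    exact CommGroup.isNilpotent
  · by_cases htop : S = ⊤
    · rw [htop]; infer_instance
    · obtain ⟨t, ht⟩ : ∃ t, t ∉ S := by
        by_contra! h
        exact htop (Subgroup.eq_top_iff' S |>.2 h)
      refine ⟨?_⟩
      -- Elements outside `S` invert `y`, so the product of two of them centralizes `y`.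
      rw [(Subgroup.index_eq_two_iff (H := S)).2 ⟨t, fun b => ?_⟩]
      · decide
      · by_cases hb : b ∈ S
        · exact Or.inr ⟨hb, fun h => ht ((Subgroup.mul_mem_cancel_left S hb).1 h)⟩
        · refine Or.inl ⟨(hS _).2 ?_, hb⟩
          refine mul_inv_eq_iff_eq_mul.1 ?_
          have h1 := neg t ht
          have h2 := neg b hb
          rw [map_mul, mul_inv_rev]
          calc ι b * ι t * y * ((ι t)⁻¹ * (ι b)⁻¹) = ι b * (ι t * y * (ι t)⁻¹) * (ι b)⁻¹ := by group
            _ = (ι b * y * (ι b)⁻¹)⁻¹ := by rw [h1]; group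
            _ = y := by rw [h2, inv_inv]

/-! ### The distance of a graph-theoretic tree is a tree metric. -/

namespace SimpleGraph.IsTree

variable {V : Type*} {T : SimpleGraph V}

theorem exists_adj_dist (hT : T.IsTree) {x y : V} (hxy : x ≠ y) :
    ∃ z, T.Adj x z ∧ T.dist z y + 1 = T.dist x y := by
  obtain ⟨p, hp⟩ := hT.connected.exists_walk_length_eq_dist x y
  cases p with
  | nil => exact absurd rfl hxy
  | @cons _ z _ hxz p =>
    refine ⟨z, hxz, ?_⟩
    have h1 := dist_le p
    have h2 := hT.dist_eq_dist_add_one_of_adj y hxz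
    rw [Walk.length_cons] at hp
    rw [dist_comm (u := y), dist_comm (u := y) (v := z)] at h2
    omega

theorem exists_between (hT : T.IsTree) (x y : V) (i : ℕ) (hi : i ≤ T.dist x y) :
    ∃ z, T.dist x z = i ∧ i + T.dist z y = T.dist x y := by
  induction i with
  | zero => exact ⟨x, dist_self, by omega⟩
  | succ i ih =>
    obtain ⟨z, h1, h2⟩ := ih (by omega)
    have hzy : z ≠ y := by rintro rfl; rw [dist_self] at h2; omega
    obtain ⟨w, h3, h4⟩ := hT.exists_adj_dist hzy
    refine ⟨w, ?_, by omega⟩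
    have h5 := hT.connected.dist_triangle (u := x) (v := w) (w := y)
    have h6 := hT.dist_eq_dist_add_one_of_adj x h3
    omega

/-- Two vertices on different sides of an edge are joined by a geodesic through this edge. -/
theorem dist_add_le (hT : T.IsTree) {x x' y w : V} (hadj : T.Adj x x')
    (hy : T.dist x' y < T.dist x y) (hw : T.dist x w < T.dist x' w) :
    T.dist y x + T.dist x w ≤ T.dist y w := by
  classical
  have through : ∀ {a b c : V} (p : T.Walk a b), c ∈ p.support →
      T.dist a c + T.dist c b ≤ p.length := fun {a b c} p hc => by
    have h1 := congrArg Walk.length (p.take_spec hc)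
    rw [Walk.length_append] at h1
    have h2 := dist_le (p.takeUntil c hc)
    have h3 := dist_le (p.dropUntil c hc)
    omega
  obtain ⟨p, hp⟩ := hT.connected.exists_walk_length_eq_dist y w
  by_cases hx : x ∈ p.support
  · rw [← hp]; exact through p hx
  exfalso
  obtain ⟨q, hq⟩ := hT.connected.exists_walk_length_eq_dist x' y
  obtain ⟨r, hr⟩ := hT.connected.exists_walk_length_eq_dist w x
  -- The walk from `x'` via `y` and `w` to `x` must cross the bridge. The middle piece avoids `x`,
  -- and the outer pieces are geodesics too short to pass through the edge.
  have hbr := isAcyclic_iff_forall_adj_isBridge.1 hT.isAcyclic hadj.symm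
  have hmem := isBridge_iff_forall_walk_mem_edges.1 hbr (q.append (p.append r))
  rw [Walk.edges_append, Walk.edges_append, List.mem_append, List.mem_append] at hmem
  rcases hmem with h | h | h
  · have := through q (q.snd_mem_support_of_mem_edges h)
    omega
  · exact hx (p.snd_mem_support_of_mem_edges h)
  · have := through r (r.fst_mem_support_of_mem_edges h)
    rw [hr, dist_comm (u := w), dist_comm (u := w)] at this
    omega

theorem isTreeMetric (hT : T.IsTree) : IsTreeMetric T.dist where
  self _ := dist_self
  eq_of_zero _ _ h := hT.connected.dist_eq_zero_iff.1 h
  symm _ _ := dist_comm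
  between := hT.exists_between
  four_point x y z w := by
    -- Moving `x` one step towards `y`: either `z` or `w` lies behind `x`, and the path to it from
    -- `y` passes through `x`, or all the distances from `x` drop by one.
    induction hn : T.dist x y generalizing x with
    | zero =>
      rw [hT.connected.dist_eq_zero_iff] at hn
      subst hn
      have := hT.connected.dist_triangle (u := z) (v := x) (w := w)
      rw [dist_comm (u := z) (v := x)] at this
      omega
    | succ n ih =>
      have hxy : x ≠ y := by rintro rfl; rw [dist_self] at hn; omega
      obtain ⟨x', hadj, hx'⟩ := hT.exists_adj_dist hxy
      have hz := hT.dist_eq_dist_add_one_of_adj z hadj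
      have hw := hT.dist_eq_dist_add_one_of_adj w hadj
      have t := hT.connected.dist_triangle (u := z) (v := x) (w := w)
      have hi := ih x' (by omega)
      simp only [dist_comm (u := z) (v := x), dist_comm (u := z) (v := x'),
        dist_comm (u := w) (v := x), dist_comm (u := w) (v := x')] at hz hw t
      by_cases h1 : T.dist x z < T.dist x' z
      · have := hT.dist_add_le (y := y) hadj (by omega) h1
        rw [dist_comm (u := y) (v := x)] at this
        omega
      · by_cases h2 : T.dist x w < T.dist x' w
        · have := hT.dist_add_le (y := y) hadj (by omega) h2
          rw [dist_comm (u := y) (v := x)] at this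
          omega
        · omega

end SimpleGraph.IsTree

/-! ### The Bass–Serre tree of an amalgamated product. -/

section CosetTree

variable {Γ : Type*} [Group Γ]

/-- Nonempty products of letters taken alternately from `P true` and `P false`, none of them in
both subgroups; the index says where the first letter comes from. -/
inductive IsAlternating (P : Bool → Subgroup Γ) : Bool → Γ → Prop
  | single (b : Bool) (g : Γ) : g ∈ P b → g ∉ P (!b) → IsAlternating P b g
  | cons (b : Bool) (g w : Γ) : g ∈ P b → g ∉ P (!b) → IsAlternating P (!b) w →
      IsAlternating P b (g * w)

/-- `Γ` is the amalgamated product of `P true` and `P false` over their intersection. -/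
structure IsAmalgam (P : Bool → Subgroup Γ) : Prop where
  closure_eq : Subgroup.closure (P true ∪ P false : Set Γ) = ⊤
  ne_one : ∀ b g, IsAlternating P b g → g ≠ 1

namespace IsAlternating

variable {P : Bool → Subgroup Γ} {b c : Bool} {g w : Γ}

theorem base_mul (hg : ∀ b, g ∈ P b) (hw : IsAlternating P c w) : IsAlternating P c (g * w) := by
  cases hw with
  | single _ _ h1 h2 =>
    exact single _ _ (mul_mem (hg _) h1) fun h => h2 ((Subgroup.mul_mem_cancel_left _ (hg _)).1 h)
  | cons _ h w h1 h2 h3 =>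
    rw [← mul_assoc]
    exact cons _ _ _ (mul_mem (hg _) h1)
      (fun h => h2 ((Subgroup.mul_mem_cancel_left _ (hg _)).1 h)) h3

theorem forall_mem (h1 : g ∈ P b) (h2 : g ∈ P (!b)) (c : Bool) : g ∈ P c := by
  cases b <;> cases c <;> assumption

/-- Every element lies in both subgroups or is an alternating product. -/
theorem cover (hP : IsAmalgam P) (g : Γ) : (∀ b, g ∈ P b) ∨ ∃ b, IsAlternating P b g := by
  let C : Γ → Prop := fun g => (∀ b, g ∈ P b) ∨ ∃ b, IsAlternating P b g
  have gen : ∀ b, ∀ g ∈ P b, ∀ w, C w → C (g * w) := by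
    intro b g hg w hw
    by_cases hgb : g ∈ P (!b)
    · have hgE := forall_mem hg hgb
      rcases hw with hw | ⟨c, hw⟩
      · exact Or.inl fun c => mul_mem (hgE c) (hw c)
      · exact Or.inr ⟨c, hw.base_mul hgE⟩
    have key : ∀ x ∈ P b, C x := fun x hx => by
      by_cases h : x ∈ P (!b)
      · exact Or.inl (forall_mem hx h)
      · exact Or.inr ⟨b, single _ _ hx h⟩
    rcases hw with hw | ⟨c, hw⟩
    · exact key _ (mul_mem hg (hw b))
    by_cases hcb : c = b
    · subst hcb
      cases hw with
      | single _ _ h1 h2 => exact key _ (mul_mem hg h1)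
      | cons _ h w h1 h2 h3 =>
        rw [← mul_assoc]
        by_cases h : g * h ∈ P (!c)
        · exact Or.inr ⟨_, h3.base_mul (forall_mem (mul_mem hg h1) h)⟩
        · exact Or.inr ⟨_, cons _ _ _ (mul_mem hg h1) h h3⟩
    · obtain rfl : c = !b := by cases b <;> cases c <;> simp_all
      exact Or.inr ⟨b, cons _ _ _ hg hgb hw⟩
  have h1 : C 1 := Or.inl fun b => one_mem _
  have main : (∀ w, C w → C (g * w)) ∧ ∀ w, C w → C (g⁻¹ * w) := by
    have hg : g ∈ Subgroup.closure (P true ∪ P false : Set Γ) := hP.closure_eq ▸ Subgroup.mem_top g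
    induction hg using Subgroup.closure_induction with
    | mem x hx =>
      rcases hx with hx | hx
      · exact ⟨gen _ _ hx, gen _ _ (inv_mem hx)⟩
      · exact ⟨gen _ _ hx, gen _ _ (inv_mem hx)⟩
    | one => simp
    | mul x y _ _ ihx ihy =>
      refine ⟨fun w hw => ?_, fun w hw => ?_⟩
      · rw [mul_assoc]; exact ihx.1 _ (ihy.1 _ hw)
      · rw [mul_inv_rev, mul_assoc]; exact ihy.2 _ (ihx.2 _ hw)
    | inv x _ ih => rw [inv_inv]; exact ih.symm
  have h2 := main.1 1 h1
  rwa [mul_one] at h2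

/-- The two claims are proved together because the index flips along the word. Only a single letter
can be absorbed into the amalgamated subgroup. -/
theorem mul_mem_aux (hg : IsAlternating P c g) :
    (∀ a ∈ P (!c), IsAlternating P c (g * a)) ∧
      ∀ a ∈ P c, IsAlternating P c (g * a) ∨ ∀ b, g * a ∈ P b := by
  induction hg with
  | single c h h1 h2 =>
    refine ⟨fun a ha => ?_, fun a ha => ?_⟩
    · by_cases hac : a ∈ P c
      · exact single _ _ (mul_mem h1 hac) fun h => h2 ((Subgroup.mul_mem_cancel_right _ ha).1 h)
      · exact cons _ _ _ h1 h2 (single _ _ ha (by rwa [Bool.not_not]))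
    · by_cases hac : h * a ∈ P (!c)
      · exact Or.inr (forall_mem (mul_mem h1 ha) hac)
      · exact Or.inl (single _ _ (mul_mem h1 ha) hac)
  | cons c h w h1 h2 h3 ih =>
    rw [Bool.not_not] at ih
    refine ⟨fun a ha => ?_, fun a ha => ?_⟩
    · rw [mul_assoc]
      rcases ih.2 a ha with h4 | h4
      · exact cons _ _ _ h1 h2 h4
      · exact single _ _ (mul_mem h1 (h4 _)) fun h =>
          h2 ((Subgroup.mul_mem_cancel_right _ (h4 _)).1 h)
    · rw [mul_assoc]
      exact Or.inl (cons _ _ _ h1 h2 (ih.1 a ha))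

theorem mul_right (hg : IsAlternating P c g) {a : Γ} (ha : a ∈ P (!c)) :
    IsAlternating P c (g * a) :=
  hg.mul_mem_aux.1 a ha

theorem inv_mul (hg : IsAlternating P c g) (hw : IsAlternating P (!c) w) :
    ∃ b, IsAlternating P b (g⁻¹ * w) := by
  induction hg generalizing w with
  | single c h h1 h2 => exact ⟨c, cons _ _ _ (inv_mem h1) (fun h => h2 (inv_mem_iff.1 h)) hw⟩
  | cons c h g h1 h2 h3 ih =>
    rw [mul_inv_rev, mul_assoc]
    refine ih ?_
    rw [Bool.not_not]
    exact cons _ _ _ (inv_mem h1) (fun h => h2 (inv_mem_iff.1 h)) hw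

/-- If `g` had alternating expressions of both types, then `g⁻¹ * g` would be an alternating product
without cancellation. -/
theorem disjoint (hP : IsAmalgam P) (hg : IsAlternating P true g) : ¬ IsAlternating P false g :=
  fun hg' => by
    obtain ⟨b, hb⟩ := hg.inv_mul hg'
    exact hP.ne_one _ _ hb (inv_mul_cancel g)

end IsAlternating

/-- The coset of `g` modulo `P b`, as a vertex. -/
def cosetVertex (P : Bool → Subgroup Γ) (b : Bool) (g : Γ) : Σ b, Γ ⧸ P b :=
  ⟨b, (g : Γ ⧸ P b)⟩

theorem cosetVertex_eq_iff {P : Bool → Subgroup Γ} {b : Bool} {g h : Γ} :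
    cosetVertex P b g = cosetVertex P b h ↔ g⁻¹ * h ∈ P b := by
  rw [cosetVertex, cosetVertex, Sigma.mk.injEq, heq_eq_eq, QuotientGroup.eq]
  exact and_iff_right rfl

theorem smul_cosetVertex {P : Bool → Subgroup Γ} (b : Bool) (g h : Γ) :
    g • cosetVertex P b h = cosetVertex P b (g * h) := rfl

theorem exists_cosetVertex {P : Bool → Subgroup Γ} (v : Σ b, Γ ⧸ P b) :
    ∃ b g, v = cosetVertex P b g := by
  obtain ⟨b, x⟩ := v
  obtain ⟨g, rfl⟩ := QuotientGroup.mk_surjective x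
  exact ⟨b, g, rfl⟩

theorem smul_cosetVertex_eq_iff {P : Bool → Subgroup Γ} {b : Bool} {g h : Γ} :
    g • cosetVertex P b h = cosetVertex P b h ↔ h⁻¹ * g * h ∈ P b := by
  rw [smul_cosetVertex, eq_comm, cosetVertex_eq_iff, mul_assoc]

/-- The graph of cosets of `P true` and `P false`. -/
def cosetGraph (P : Bool → Subgroup Γ) : SimpleGraph (Σ b, Γ ⧸ P b) where
  Adj u v := ∃ b g, u = cosetVertex P b g ∧ v = cosetVertex P (!b) g
  symm := ⟨fun u v ⟨b, g, hu, hv⟩ => ⟨!b, g, hv, by rwa [Bool.not_not]⟩⟩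
  loopless := ⟨fun u ⟨b, g, hu, hv⟩ => by
    have := congrArg Sigma.fst (hu.symm.trans hv)
    simp [cosetVertex] at this⟩

namespace cosetGraph

variable {P : Bool → Subgroup Γ}

theorem adj_cosetVertex (b : Bool) (g : Γ) :
    (cosetGraph P).Adj (cosetVertex P b g) (cosetVertex P (!b) g) := ⟨b, g, rfl, rfl⟩

theorem adj_smul (g : Γ) {u v : Σ b, Γ ⧸ P b} (h : (cosetGraph P).Adj u v) :
    (cosetGraph P).Adj (g • u) (g • v) := by
  obtain ⟨b, k, rfl, rfl⟩ := h
  exact ⟨b, g * k, rfl, rfl⟩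

theorem fst_ne {u v : Σ b, Γ ⧸ P b} (h : (cosetGraph P).Adj u v) : u.1 ≠ v.1 := by
  obtain ⟨b, k, rfl, rfl⟩ := h
  simp [cosetVertex]

theorem reachable_smul (g : Γ) {u v : Σ b, Γ ⧸ P b} (h : (cosetGraph P).Reachable u v) :
    (cosetGraph P).Reachable (g • u) (g • v) := by
  obtain ⟨p⟩ := h
  induction p with
  | nil => exact SimpleGraph.Reachable.refl _
  | cons h _ ih => exact (adj_smul g h).reachable.trans ih

theorem reachable_self (b c : Bool) (g : Γ) :
    (cosetGraph P).Reachable (cosetVertex P b g) (cosetVertex P c g) := by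
  by_cases h : c = b
  · rw [h]
  · obtain rfl : c = !b := by cases b <;> cases c <;> simp_all
    exact (adj_cosetVertex b g).reachable

theorem connected (hP : IsAmalgam P) : (cosetGraph P).Connected := by
  have main : ∀ g : Γ, (cosetGraph P).Reachable (cosetVertex P true g) (cosetVertex P true 1) := by
    intro g
    have hg : g ∈ Subgroup.closure (P true ∪ P false : Set Γ) := hP.closure_eq ▸ Subgroup.mem_top g
    induction hg using Subgroup.closure_induction with
    | mem x hx =>
      obtain ⟨b, hb⟩ : ∃ b, x ∈ P b := by rcases hx with hx | hx <;> exact ⟨_, hx⟩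
      have h1 : cosetVertex P b x = cosetVertex P b 1 := by
        rw [cosetVertex_eq_iff, mul_one]; exact inv_mem hb
      exact (reachable_self true b x).trans (h1 ▸ reachable_self b true 1)
    | one => rfl
    | mul x y _ _ ihx ihy =>
      have h1 := reachable_smul x ihy
      rw [smul_cosetVertex, smul_cosetVertex, mul_one] at h1
      exact h1.trans ihx
    | inv x _ ih =>
      have h1 := reachable_smul x⁻¹ ih
      rw [smul_cosetVertex, smul_cosetVertex, mul_one, inv_mul_cancel] at h1
      exact h1.symm
  have main' : ∀ v, (cosetGraph P).Reachable v (cosetVertex P true 1) := fun v => by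
    obtain ⟨b, g, rfl⟩ := exists_cosetVertex v
    exact (reachable_self b true g).trans (main g)
  exact { preconnected := fun u v => (main' u).trans (main' v).symm
          nonempty := ⟨cosetVertex P true 1⟩ }

/-- The vertices beyond the edge from `P true` to `P false`. -/
def farSide (P : Bool → Subgroup Γ) (v : Σ b, Γ ⧸ P b) : Prop :=
  ∃ g, v = cosetVertex P true g ∧ IsAlternating P false g ∨
    v = cosetVertex P false g ∧ ¬ IsAlternating P true g

theorem farSide_true {g : Γ} : farSide P (cosetVertex P true g) ↔ IsAlternating P false g := by
  refine ⟨?_, fun h => ⟨g, Or.inl ⟨rfl, h⟩⟩⟩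
  rintro ⟨h, ⟨h1, h2⟩ | ⟨h1, -⟩⟩
  · rw [eq_comm, cosetVertex_eq_iff] at h1
    simpa using h2.mul_right h1
  · exact absurd (congrArg Sigma.fst h1) (by simp [cosetVertex])

theorem farSide_false {g : Γ} : farSide P (cosetVertex P false g) ↔ ¬ IsAlternating P true g := by
  refine ⟨?_, fun h => ⟨g, Or.inr ⟨rfl, h⟩⟩⟩
  rintro ⟨h, ⟨h1, -⟩ | ⟨h1, h2⟩⟩ h3
  · exact absurd (congrArg Sigma.fst h1) (by simp [cosetVertex])
  · rw [cosetVertex_eq_iff] at h1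
    exact h2 (by simpa using h3.mul_right h1)

/-- Only the base edge has its ends on different sides: the type of an alternating `g` puts both
cosets of `g` on the same side. -/
theorem edge_eq (hP : IsAmalgam P) (g : Γ)
    (h : ¬ (farSide P (cosetVertex P true g) ↔ farSide P (cosetVertex P false g))) (b : Bool) :
    cosetVertex P b g = cosetVertex P b 1 := by
  rw [farSide_true, farSide_false] at h
  rw [cosetVertex_eq_iff, mul_one]
  refine inv_mem ?_
  rcases IsAlternating.cover hP g with h1 | ⟨c, hc⟩
  · exact h1 b
  · exfalso
    cases c with
    | false => exact h ⟨fun _ h2 => IsAlternating.disjoint hP h2 hc, fun _ => hc⟩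
    | true => exact h ⟨fun h2 => absurd h2 (IsAlternating.disjoint hP hc), fun h2 => absurd hc h2⟩

/-- Translating by `g⁻¹` reduces to the base edge: a walk changing sides must cross it. As every
edge is a translate of the base edge, all edges are bridges. -/
theorem mem_edges (hP : IsAmalgam P) {u v : Σ b, Γ ⧸ P b} (p : (cosetGraph P).Walk u v) (g : Γ)
    (h : ¬ (farSide P (g⁻¹ • u) ↔ farSide P (g⁻¹ • v))) :
    s(cosetVertex P true g, cosetVertex P false g) ∈ p.edges := by
  induction p with
  | nil => exact absurd Iff.rfl h
  | @cons u w v huw p ih =>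
    rw [SimpleGraph.Walk.edges_cons, List.mem_cons]
    by_cases h1 : farSide P (g⁻¹ • u) ↔ farSide P (g⁻¹ • w)
    · exact Or.inr (ih fun h2 => h (h1.trans h2))
    · left
      obtain ⟨b, k, rfl, rfl⟩ := huw
      rw [smul_cosetVertex, smul_cosetVertex] at h1
      have h2 : ¬ (farSide P (cosetVertex P true (g⁻¹ * k)) ↔
          farSide P (cosetVertex P false (g⁻¹ * k))) := by
        cases b with
        | true => exact h1
        | false => exact fun h => h1 h.symm
      have h3 : ∀ b, cosetVertex P b k = cosetVertex P b g := fun b => by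
        have := congrArg (g • ·) (edge_eq hP _ h2 b)
        simpa only [smul_cosetVertex, mul_inv_cancel_left, mul_one] using this
      rw [h3, h3]
      cases b with
      | true => rfl
      | false => exact Sym2.eq_swap

theorem isTree (hP : IsAmalgam P) : (cosetGraph P).IsTree where
  connected := connected hP
  isAcyclic := by
    have key : ∀ g, (cosetGraph P).IsBridge s(cosetVertex P true g, cosetVertex P false g) :=
      fun g => SimpleGraph.isBridge_iff_forall_walk_mem_edges.2 fun p => mem_edges hP p g <| by
        rw [smul_cosetVertex, smul_cosetVertex, inv_mul_cancel, farSide_true, farSide_false]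
        exact fun h => hP.ne_one _ _ (h.2 fun h => hP.ne_one _ _ h rfl) rfl
    rw [SimpleGraph.isAcyclic_iff_forall_adj_isBridge]
    rintro _ _ ⟨b, g, rfl, rfl⟩
    cases b with
    | true => exact key g
    | false => rw [Sym2.eq_swap]; exact key g

theorem dist_smul (g : Γ) (hP : IsAmalgam P) (u v : Σ b, Γ ⧸ P b) :
    (cosetGraph P).dist (g • u) (g • v) = (cosetGraph P).dist u v := by
  have aux : ∀ (g : Γ) (u v : Σ b, Γ ⧸ P b),
      (cosetGraph P).dist (g • u) (g • v) ≤ (cosetGraph P).dist u v := fun g u v => by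
    obtain ⟨p, hp⟩ := (connected hP).exists_walk_length_eq_dist u v
    let f : cosetGraph P →g cosetGraph P := ⟨(g • ·), adj_smul g⟩
    rw [← hp, ← SimpleGraph.Walk.length_map f p]
    exact SimpleGraph.dist_le (p.map f)
  refine le_antisymm (aux g u v) ?_
  have := aux g⁻¹ (g • u) (g • v)
  rwa [inv_smul_smul, inv_smul_smul] at this

/-- The coset graph of an amalgamated product is a tree, on which the action is acylindrical as
soon as no nontrivial element of the amalgamated subgroup fixes edges on both sides. -/
theorem isAcylindrical (hP : IsAmalgam P)
    (hac : ∀ z, (∀ b, z ∈ P b) → ∀ k : Bool → Γ, (∀ b, k b ∈ P b) → (∀ b, k b ∉ P (!b)) →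
      (∀ b, (k b)⁻¹ * z * k b ∈ P (!b)) → z = 1) :
    IsAcylindrical Γ (cosetGraph P).dist := by
  have hT := isTree hP
  have hM := hT.isTreeMetric
  refine { hM with smul := fun g => dist_smul g hP, even := fun g x => ?_, eq_one := ?_ }
  · obtain ⟨p, hp⟩ := hT.connected.exists_walk_length_eq_dist x (g • x)
    -- The type of coset is a proper 2-colouring preserved by the action.
    let c : (cosetGraph P).Coloring Bool := SimpleGraph.Coloring.mk Sigma.fst fst_ne
    rw [← hp, c.even_length_iff_congr]
    exact Iff.rfl
  · intro z p q hpq hp hq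
    have fix : ∀ {p q v : Σ b, Γ ⧸ P b}, z • p = p → z • q = q →
        (cosetGraph P).dist p v + (cosetGraph P).dist v q = (cosetGraph P).dist p q →
        z • v = v := fun {p q v} hp hq hv => by
      have h1 := dist_smul z hP p v
      have h2 := dist_smul z hP v q
      rw [hp] at h1
      rw [hq] at h2
      exact hM.eq_of_dist_eq hv h1 h2
    -- The path `p, v, w, x` is fixed by `z`. Moving its middle edge to the base edge turns the two
    -- outer edges into the elements `k true` and `k false` of the hypothesis.
    obtain ⟨v, hv1, hv2⟩ := hM.between p q 1 (by omega)
    obtain ⟨w, hw1, hw2⟩ := hM.between v q 1 (by omega)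
    obtain ⟨x, hx1, hx2⟩ := hM.between w q 1 (by omega)
    have zv := fix hp hq (v := v) (by omega)
    have zw := fix zv hq (v := w) (by omega)
    have zx := fix zw hq (v := x) (by omega)
    have hpw : p ≠ w := by rintro rfl; omega
    have hvx : v ≠ x := by rintro rfl; omega
    rw [SimpleGraph.dist_eq_one_iff_adj] at hv1 hw1 hx1
    obtain ⟨b, g, rfl, rfl⟩ := hw1
    obtain ⟨c, k, hk1, hk2⟩ := hv1.symm
    obtain ⟨c', k', hk1', hk2'⟩ := hx1
    obtain rfl : b = c := congrArg Sigma.fst hk1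
    obtain rfl : (!b) = c' := congrArg Sigma.fst hk1'
    rw [hk2] at hp hpw
    rw [hk2', Bool.not_not] at zx hvx
    rw [cosetVertex_eq_iff] at hk1 hk1'
    rw [ne_eq, cosetVertex_eq_iff] at hvx
    rw [ne_eq, eq_comm, cosetVertex_eq_iff] at hpw
    rw [smul_cosetVertex_eq_iff] at hp zx zv zw
    have hz := hac (g⁻¹ * z * g) (IsAlternating.forall_mem zv zw)
      (fun c => if c = b then g⁻¹ * k else g⁻¹ * k') ?_ ?_ ?_
    · have h1 : z = g * (g⁻¹ * z * g) * g⁻¹ := by group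
      rw [h1, hz, mul_one, mul_inv_cancel]
    · intro c
      by_cases h : c = b
      · rw [if_pos h, h]; exact hk1
      · rw [if_neg h]
        obtain rfl : c = !b := by cases b <;> cases c <;> simp_all
        exact hk1'
    · intro c
      by_cases h : c = b
      · rw [if_pos h, h]; exact hpw
      · rw [if_neg h]
        obtain rfl : c = !b := by cases b <;> cases c <;> simp_all
        rw [Bool.not_not]; exact hvx
    · intro c
      by_cases h : c = b
      · rw [if_pos h, h]; convert hp using 1; group
      · rw [if_neg h]
        obtain rfl : c = !b := by cases b <;> cases c <;> simp_all
        rw [Bool.not_not]; convert zx using 1; group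

end cosetGraph

end CosetTree

/-! ### Construction of amalgamated products. -/

open Monoid in
/-- A pushout of two injections is an amalgamated product. -/
theorem isAmalgam_pushoutI {D : Type*} {G : Bool → Type*} [Group D] [∀ b, Group (G b)]
    {φ : ∀ b, D →* G b} (hφ : ∀ b, Function.Injective (φ b)) :
    IsAmalgam (fun b => (PushoutI.of (φ := φ) b).range) := by
  have hbase : ∀ b d, PushoutI.of b (φ b d) = PushoutI.base φ d := PushoutI.of_apply_eq_base φ
  refine ⟨?_, ?_⟩
  · rw [Subgroup.eq_top_iff']
    intro g
    induction g using PushoutI.induction_on with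
    | of b g =>
      refine Subgroup.subset_closure ?_
      cases b with
      | true => exact Or.inl ⟨g, rfl⟩
      | false => exact Or.inr ⟨g, rfl⟩
    | base d => exact Subgroup.subset_closure (Or.inl ⟨φ true d, hbase true d⟩)
    | mul x y hx hy => exact mul_mem hx hy
  · have letter : ∀ b (a : G b), PushoutI.of (φ := φ) b a ∉ (PushoutI.of (φ := φ) (!b)).range →
        a ∉ (φ b).range ∧ a ≠ 1 := fun b a ha =>
      ⟨fun ⟨d, hd⟩ => ha ⟨φ (!b) d, by rw [← hd, hbase, hbase]⟩,
        fun h => ha (by rw [h, map_one]; exact one_mem _)⟩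
    have word : ∀ b g, IsAlternating (fun b => (PushoutI.of (φ := φ) b).range) b g →
        ∃ w : CoprodI.Word G, PushoutI.Reduced φ w ∧ w.fstIdx = some b ∧
          PushoutI.ofCoprodI w.prod = g := by
      intro b g hg
      induction hg with
      | single b g h1 h2 =>
        obtain ⟨a, rfl⟩ := h1
        obtain ⟨h3, h4⟩ := letter b a h2
        refine ⟨CoprodI.Word.cons a CoprodI.Word.empty (by simp [CoprodI.Word.fstIdx]) h4,
          ?_, by simp, by simp⟩
        intro l hl
        simp only [CoprodI.Word.cons, CoprodI.Word.empty, List.mem_singleton] at hl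
        rw [hl]; exact h3
      | cons b g w h1 h2 _ ih =>
        obtain ⟨a, rfl⟩ := h1
        obtain ⟨h3, h4⟩ := letter b a h2
        obtain ⟨v, hv1, hv2, rfl⟩ := ih
        refine ⟨CoprodI.Word.cons a v (by simp [hv2]) h4, ?_, by simp, by simp⟩
        intro l hl
        simp only [CoprodI.Word.cons, List.mem_cons] at hl
        rcases hl with rfl | hl
        · exact h3
        · exact hv1 l hl
    -- By the normal form theorem, a reduced word with value in the base is empty, whereas this one
    -- has a first letter.
    rintro b g hg rfl
    obtain ⟨w, h1, h2, h3⟩ := word b 1 hg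
    rw [h1.eq_empty_of_mem_range hφ (h3 ▸ one_mem _)] at h2
    simp [CoprodI.Word.fstIdx] at h2

/-- The family with members `K` and `L`. -/
def BoolPair (K L : Type u) : Bool → Type u
  | true => K
  | false => L

instance BoolPair.instGroup (K L : Type u) [Group K] [Group L] : ∀ b, Group (BoolPair K L b)
  | true => ‹Group K›
  | false => ‹Group L›

/-- The family with members `i` and `j`. -/
def BoolPair.hom {K L D : Type u} [Group K] [Group L] [Group D] (i : D →* K) (j : D →* L) :
    ∀ b, D →* BoolPair K L b
  | true => i
  | false => j

open Monoid in
/-- Amalgamated products exist. -/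
theorem exists_isAmalgam {K D D' : Type u} [Group K] [Group D] [Group D'] (i : D →* K)
    (j : D →* D') (hi : Function.Injective i) (hj : Function.Injective j) :
    ∃ (Γ : Type u) (_ : Group Γ) (f : K →* Γ) (g : D' →* Γ) (P : Bool → Subgroup Γ),
      Function.Injective f ∧ Function.Injective g ∧ (∀ d, f (i d) = g (j d)) ∧
      P true = f.range ∧ P false = g.range ∧ IsAmalgam P ∧
      ∀ k, (∀ b, k ∈ P b) → ∃ d, k = f (i d) := by
  let φ := BoolPair.hom i j
  have hφ : ∀ b, Function.Injective (φ b) := fun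
    | true => hi
    | false => hj
  have hbase : ∀ b d, PushoutI.of b (φ b d) = PushoutI.base φ d := PushoutI.of_apply_eq_base φ
  refine ⟨PushoutI φ, inferInstance, PushoutI.of (φ := φ) true, PushoutI.of (φ := φ) false,
    fun b => (PushoutI.of (φ := φ) b).range, PushoutI.of_injective hφ true,
    PushoutI.of_injective hφ false, fun d => (hbase true d).trans (hbase false d).symm, rfl, rfl,
    isAmalgam_pushoutI hφ, ?_⟩
  · intro k hk
    have := (PushoutI.inf_of_range_eq_base_range (φ := φ) hφ (i := true) (j := false)
      (by decide)).le ⟨hk true, hk false⟩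
    obtain ⟨d, rfl⟩ := this
    exact ⟨d, (hbase true d).symm⟩

/-! ### Localization of abelian and dihedral-type groups. -/

theorem isPrimeToSet_prime {π : Set Nat.Primes} {q : Nat.Primes} (hq : q ∉ π) :
    IsPrimeToSet π q :=
  ⟨q.2.pos, fun p hp => by rwa [Subtype.ext ((Nat.prime_dvd_prime_iff_eq p.2 q.2).1 hp)]⟩

theorem IsPrimeToSet.mul {π : Set Nat.Primes} {m n : ℕ} (hm : IsPrimeToSet π m)
    (hn : IsPrimeToSet π n) : IsPrimeToSet π (m * n) :=
  ⟨Nat.mul_pos hm.1 hn.1, fun p hp => (p.2.dvd_mul.1 hp).elim (hm.2 p) (hn.2 p)⟩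

theorem IsPiLocal.bijective_pow {π : Set Nat.Primes} {G : Type u} [Group G] (hG : IsPiLocal π G)
    {m : ℕ} (hm : IsPrimeToSet π m) : Function.Bijective (fun x : G => x ^ m) := by
  induction m using Nat.recOnMul with
  | zero => exact absurd hm.1 (lt_irrefl 0)
  | one =>
    rw [show (fun x : G => x ^ 1) = id from funext pow_one]
    exact Function.bijective_id
  | prime p hp => exact hG ⟨p, hp⟩ (hm.2 ⟨p, hp⟩ (dvd_refl _))
  | mul a b iha ihb =>
    have ha := iha ⟨Nat.pos_of_mul_pos_right hm.1, fun p hp => hm.2 p (hp.mul_right b)⟩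
    have hb := ihb ⟨Nat.pos_of_mul_pos_left hm.1, fun p hp => hm.2 p (hp.mul_left a)⟩
    have : (fun x : G => x ^ (a * b)) = (fun x => x ^ b) ∘ fun x => x ^ a := by
      funext x; exact pow_mul x a b
    rw [this]
    exact hb.comp ha

theorem IsPiLocal.isUPi {π : Set Nat.Primes} {G : Type u} [Group G] (hG : IsPiLocal π G) :
    IsUPi π G := fun _ hm => (hG.bijective_pow hm).1

theorem IsUPi.of_injective {π : Set Nat.Primes} {G H : Type*} [Group G] [Group H]
    (hH : IsUPi π H) {f : G →* H} (hf : Function.Injective f) : IsUPi π G :=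
  fun m hm x y hxy => hf (hH m hm (by simpa only [map_pow] using congrArg f hxy))

/-- This is the localization of an `ℕ`-module at the multiplicative set of `π'`-numbers; uniqueness
of roots makes the canonical map injective. -/
theorem exists_commGroup_localization {π : Set Nat.Primes} (A : Type u) [CommGroup A]
    (hA : IsUPi π A) :
    ∃ (A' : Type u) (_ : CommGroup A') (ι : A →* A'), Function.Injective ι ∧ IsPiLocal π A' ∧
      ∀ a : A', ∃ m, IsPrimeToSet π m ∧ a ^ m ∈ ι.range := by
  let S : Submonoid ℕ :=
    { carrier := {m | IsPrimeToSet π m}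
      mul_mem' := fun ha hb => ha.mul hb
      one_mem' := ⟨one_pos, fun q hq => absurd (Nat.dvd_one.1 hq) q.2.one_lt.ne'⟩ }
  let M := LocalizedModule S (Additive A)
  have cancel : ∀ (s : S) (a b : Additive A), (s : ℕ) • a = (s : ℕ) • b → a = b :=
    fun s a b hab => hA s s.2 hab
  have smul_mk : ∀ (n : ℕ) (m : Additive A) (s : S),
      n • (LocalizedModule.mk m s : M) = LocalizedModule.mk (n • m) s := fun n m s => by
    induction n with
    | zero => rw [zero_nsmul, zero_nsmul, LocalizedModule.zero_mk]
    | succ n ih =>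
      rw [succ_nsmul, succ_nsmul, ih, LocalizedModule.mk_add_mk, ← smul_add,
        LocalizedModule.mk_cancel_common_left]
  let ι : Additive A →+ M :=
    { toFun := fun a => LocalizedModule.mk a 1
      map_zero' := LocalizedModule.zero_mk 1
      map_add' := fun a b => by
        change (LocalizedModule.mk (a + b) 1 : M) = LocalizedModule.mk a 1 + LocalizedModule.mk b 1
        rw [LocalizedModule.mk_add_mk, one_smul, one_smul, mul_one] }
  refine ⟨Multiplicative M, inferInstance, AddMonoidHom.toMultiplicativeRight ι,
    fun a b hab => ?_, fun q hq => ⟨fun a b hab => ?_, fun a => ?_⟩, fun a => ?_⟩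
  · obtain ⟨u, hu⟩ := LocalizedModule.mk_eq.1 hab
    rw [one_smul, one_smul] at hu
    exact cancel u _ _ hu
  · induction a, b using LocalizedModule.induction_on₂ with
    | h m m' s s' =>
      have h1 : (q : ℕ) • (LocalizedModule.mk m s : M) = (q : ℕ) • LocalizedModule.mk m' s' := hab
      rw [smul_mk, smul_mk, LocalizedModule.mk_eq] at h1
      obtain ⟨u, hu⟩ := h1
      refine LocalizedModule.mk_eq.2 ⟨u, cancel ⟨q, isPrimeToSet_prime hq⟩ _ _ ?_⟩
      simpa only [Submonoid.smul_def, smul_smul, mul_comm, mul_left_comm] using hu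
  · induction a using LocalizedModule.induction_on with
    | h m s =>
      let t : S := ⟨q, isPrimeToSet_prime hq⟩
      refine ⟨(LocalizedModule.mk m (t * s) : M), ?_⟩
      change (q : ℕ) • (LocalizedModule.mk m (t * s) : M) = LocalizedModule.mk m s
      rw [smul_mk]
      exact LocalizedModule.mk_cancel_common_left t s m
  · induction a using LocalizedModule.induction_on with
    | h m s =>
      refine ⟨s, s.2, m.toMul, ?_⟩
      change LocalizedModule.mk m 1 = (s : ℕ) • (LocalizedModule.mk m s : M)
      rw [smul_mk]
      exact (LocalizedModule.mk_cancel s m).symm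

/-- The inversion action of `ℤˣ` on a commutative group, restricted to a subgroup. -/
def signAction (A : Type*) [CommGroup A] (R : Subgroup ℤˣ) : R →* MulAut A where
  toFun s :=
    { toFun := fun a => a ^ ((s : ℤˣ) : ℤ)
      invFun := fun a => a ^ ((s : ℤˣ) : ℤ)
      left_inv := fun a => by
        change (a ^ ((s : ℤˣ) : ℤ)) ^ ((s : ℤˣ) : ℤ) = a
        rw [← zpow_mul, Int.units_coe_mul_self, zpow_one]
      right_inv := fun a => by
        change (a ^ ((s : ℤˣ) : ℤ)) ^ ((s : ℤˣ) : ℤ) = a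
        rw [← zpow_mul, Int.units_coe_mul_self, zpow_one]
      map_mul' := fun a b => mul_zpow a b _ }
  map_one' := by ext a; exact zpow_one a
  map_mul' s t := by
    ext a
    change a ^ (((s : ℤˣ) * (t : ℤˣ) : ℤˣ) : ℤ) = (a ^ ((t : ℤˣ) : ℤ)) ^ ((s : ℤˣ) : ℤ)
    rw [Units.val_mul, ← zpow_mul, mul_comm]

theorem signAction_apply {A : Type*} [CommGroup A] {R : Subgroup ℤˣ} (s : R) (a : A) :
    signAction A R s a = a ^ ((s : ℤˣ) : ℤ) := rfl

theorem conj_mul_conj {H : Type*} [Group H] (u v w : H) :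
    v * ((u * v)⁻¹ * w * (u * v)) * v⁻¹ = u⁻¹ * w * u := by
  group

/-- Let `ε : D → ℤˣ` have an abelian kernel, outside which there are only involutions. Then `D`
embeds in a `π`-local group with the same structure, generated by `D` and by roots of elements of
the kernel. -/
theorem exists_dihedral_localization {π : Set Nat.Primes} {D : Type u} [Group D] (ε : D →* ℤˣ)
    (hcomm : ∀ a b, ε a = 1 → ε b = 1 → a * b = b * a) (hD : IsUPi π D)
    (hinv : ∀ d, ε d ≠ 1 → d ^ 2 = 1) :
    ∃ (D' : Type u) (_ : Group D') (j : D →* D'), Function.Injective j ∧ IsPiLocal π D' ∧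
      (∀ a : D', ∃ (c : D') (d : D), a = c * j d ∧
        ∃ m, IsPrimeToSet π m ∧ ∃ k, ε k = 1 ∧ c ^ m = j k) ∧
      ∀ z, ε z ≠ 1 → ∀ a, a⁻¹ * j z * a ∈ j.range → a ∈ j.range := by
  classical
  let _ : CommGroup ε.ker := { (inferInstance : Group ε.ker) with
    mul_comm := fun a b => Subtype.ext (hcomm a b a.2 b.2) }
  obtain ⟨A, _, ι, hι, hA, hroot⟩ := exists_commGroup_localization ε.ker
    (hD.of_injective ε.ker.subtype_injective)
  let D' := A ⋊[signAction A ε.range] ε.range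
  -- If an element has nontrivial sign, it is a nontrivial involution, so uniqueness of roots
  -- excludes 2 from `π'`.
  have two_mem : ∀ d, ε d ≠ 1 → ∀ m, IsPrimeToSet π m → m % 2 = 1 := fun d hd m hm => by
    by_contra h
    have h2 : IsPrimeToSet π 2 := by
      refine isPrimeToSet_prime (q := ⟨2, Nat.prime_two⟩) (hm.2 _ ?_)
      change 2 ∣ m
      omega
    have := hD 2 h2 (show d ^ 2 = 1 ^ 2 by rw [hinv d hd, one_pow])
    exact hd (by rw [this, map_one])
  obtain ⟨t, ht⟩ : ∃ t, ∀ d, ε d ≠ 1 → ε t = -1 := by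
    by_cases h : ∃ t, ε t ≠ 1
    · obtain ⟨t, ht⟩ := h
      exact ⟨t, fun _ _ => (Int.units_eq_one_or _).resolve_left ht⟩
    · exact ⟨1, fun d hd => absurd ⟨d, hd⟩ h⟩
  have neg : ∀ d, ε d ≠ 1 → ε d = -1 := fun d hd => (Int.units_eq_one_or _).resolve_left hd
  have conj : ∀ d a, ε d ≠ 1 → ε a = 1 → d * a * d⁻¹ = a⁻¹ := fun d a hd ha => by
    have h1 := hinv (d * a) (by rwa [map_mul, ha, mul_one])
    have h2 := hinv d hd
    rw [pow_two] at h1 h2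
    rw [inv_eq_of_mul_eq_one_left h2]
    exact eq_inv_of_mul_eq_one_left (by rwa [mul_assoc (d * a)])
  -- The representative `1` or `t` of the coset of `d` modulo the kernel; `p d` below is the kernel
  -- part of `d`. The involution `t` splits the extension.
  let τ : D → D := fun d => if ε d = 1 then 1 else t
  have hτ : ∀ d, ε (d * (τ d)⁻¹) = 1 := fun d => by
    by_cases h : ε d = 1
    · simp [τ, h]
    · simp [τ, ht d h, neg d h]
  let p : D → ε.ker := fun d => ⟨d * (τ d)⁻¹, hτ d⟩
  let j : D →* D' :=
    { toFun := fun d => ⟨ι (p d), ⟨ε d, d, rfl⟩⟩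
      map_one' := by
        have h1 : p 1 = 1 := Subtype.ext (by simp [p, τ])
        exact SemidirectProduct.ext (by rw [h1, map_one]; rfl) (Subtype.ext (map_one ε))
      map_mul' := fun d e => by
        refine SemidirectProduct.ext ?_ (Subtype.ext (map_mul ε d e))
        rw [SemidirectProduct.mul_left, signAction_apply, ← map_zpow, ← map_mul]
        refine congrArg ι (Subtype.ext ?_)
        change d * e * (τ (d * e))⁻¹ = d * (τ d)⁻¹ * (p e ^ (ε d : ℤ) : ε.ker)
        by_cases hd : ε d = 1
        · rw [hd, Units.val_one, zpow_one]
          simp [p, τ, hd, mul_assoc]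
        · have h1 := ht d hd
          rw [neg d hd, Units.val_neg, Units.val_one, zpow_neg, zpow_one, Subgroup.coe_inv]
          change _ = d * (τ d)⁻¹ * (e * (τ e)⁻¹)⁻¹
          by_cases he : ε e = 1
          · have h2 := conj t e (by rw [h1]; decide) he
            simp only [τ, map_mul, hd, he, mul_one, if_false, if_true, inv_one]
            rw [← h2]
            group
          · have h2 := hinv e he
            rw [pow_two] at h2
            have h3 : e = e⁻¹ := (inv_eq_of_mul_eq_one_left h2).symm
            simp only [τ, map_mul, neg d hd, neg e he, mul_neg, mul_one, neg_neg,
              if_true, inv_one, mul_inv_rev, inv_inv]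
            nth_rw 1 [h3]
            group }
  have hinl : ∀ x : D', x.right = 1 → x = SemidirectProduct.inl x.left := fun x hx =>
    SemidirectProduct.ext rfl hx
  have hjk : ∀ k : ε.ker, j k = SemidirectProduct.inl (ι k) := fun k => by
    refine SemidirectProduct.ext (congrArg ι (Subtype.ext ?_)) (Subtype.ext k.2)
    change (k : D) * (τ k)⁻¹ = k
    have hk : ε (k : D) = 1 := k.2
    simp only [τ]
    rw [if_pos hk, inv_one, mul_one]
  -- Outside `A` all elements are involutions and `m` is odd, so each is its own `m`-th root.
  have hpow : ∀ x : D', x.right ≠ 1 → ∀ m, IsPrimeToSet π m → x ^ m = x := fun x hx m hm => by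
    obtain ⟨d, hd⟩ := x.right.2
    have hd1 : ε d ≠ 1 := fun h => hx (Subtype.ext (hd.symm.trans h))
    have hs : (x.right : ℤˣ) = -1 := hd.symm.trans (neg d hd1)
    have hsq : x ^ 2 = 1 := by
      rw [pow_two]
      refine SemidirectProduct.ext ?_ (Subtype.ext (Int.units_mul_self _))
      rw [SemidirectProduct.mul_left, signAction_apply, hs]
      simp
    obtain ⟨k, rfl⟩ : ∃ k, m = 2 * k + 1 := ⟨m / 2, by have := two_mem d hd1 m hm; omega⟩
    rw [pow_succ, pow_mul, hsq, one_pow, one_mul]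
  have hpow_right : ∀ (x : D') m, (x ^ m).right = x.right ^ m := fun x m =>
    map_pow SemidirectProduct.rightHom x m
  refine ⟨D', inferInstance, j, ?_, ?_, ?_, ?_⟩
  · rw [injective_iff_map_eq_one]
    intro d hd
    have h1 : ε d = 1 := congrArg (fun x : D' => (x.right : ℤˣ)) hd
    have h2 : p d = 1 := hι ((congrArg SemidirectProduct.left hd).trans (map_one ι).symm)
    have h3 : d * (τ d)⁻¹ = 1 := congrArg Subtype.val h2
    simpa [τ, h1] using h3
  · intro q hq
    have hq' := isPrimeToSet_prime hq
    refine ⟨fun x y hxy => ?_, fun x => ?_⟩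
    · simp only at hxy
      have hr := congrArg SemidirectProduct.right hxy
      by_cases hx : x.right = 1
      · have hy : y.right = 1 := by
          by_contra hy
          rw [hpow y hy _ hq', hpow_right, hx, one_pow] at hr
          exact hy hr.symm
        rw [hinl x hx, hinl y hy, ← map_pow, ← map_pow, SemidirectProduct.inl_inj] at hxy
        rw [hinl x hx, hinl y hy, (hA q hq).1 hxy]
      · have hy : y.right ≠ 1 := fun hy => by
          rw [hpow x hx _ hq', hpow_right, hy, one_pow] at hr
          exact hx hr
        rwa [hpow x hx _ hq', hpow y hy _ hq'] at hxy
    · by_cases hx : x.right = 1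
      · obtain ⟨a, ha⟩ := (hA q hq).2 x.left
        refine ⟨SemidirectProduct.inl a, ?_⟩
        simp only at ha ⊢
        rw [← map_pow, ha, ← hinl x hx]
      · exact ⟨x, hpow x hx _ hq'⟩
  · intro a
    obtain ⟨d, hd⟩ := a.right.2
    refine ⟨a * (j d)⁻¹, d, (inv_mul_cancel_right _ _).symm, ?_⟩
    have hr : (a * (j d)⁻¹).right = 1 := by
      rw [SemidirectProduct.mul_right, SemidirectProduct.inv_right, mul_inv_eq_one]
      exact Subtype.ext hd.symm
    obtain ⟨m, hm, k, hk⟩ := hroot (a * (j d)⁻¹).left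
    refine ⟨m, hm, k, k.2, ?_⟩
    rw [hjk, hk, map_pow, ← hinl _ hr]
  · intro z hz a ha
    obtain ⟨d, hd⟩ := a.right.2
    have hr : (a * (j d)⁻¹).right = 1 := by
      rw [SemidirectProduct.mul_right, SemidirectProduct.inv_right, mul_inv_eq_one]
      exact Subtype.ext hd.symm
    set c := (a * (j d)⁻¹).left with hc
    have hac : a = SemidirectProduct.inl c * j d := by
      rw [← hinl _ hr, inv_mul_cancel_right]
    have h1 : (SemidirectProduct.inl c : D')⁻¹ * j z * SemidirectProduct.inl c ∈ j.range := by
      have h2 := mul_mem (mul_mem (⟨d, rfl⟩ : j d ∈ j.range) ha) (inv_mem (⟨d, rfl⟩ : j d ∈ j.range))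
      rwa [hac, conj_mul_conj] at h2
    have h3 : (SemidirectProduct.inl c : D')⁻¹ * j z * SemidirectProduct.inl c * (j z)⁻¹ ∈ j.range :=
      mul_mem h1 (inv_mem ⟨z, rfl⟩)
    -- Since `j z` inverts `A`, the commutator is `c⁻¹ * c⁻¹`. So the square of `c` comes from `D`,
    -- as does an odd power of `c`, and therefore `c` itself.
    have h4 : (SemidirectProduct.inl c : D')⁻¹ * j z * SemidirectProduct.inl c * (j z)⁻¹ =
        SemidirectProduct.inl (c⁻¹ * c⁻¹) := by
      have h5 : j z * SemidirectProduct.inl c * (j z)⁻¹ = SemidirectProduct.inl c⁻¹ := by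
        rw [mul_inv_eq_iff_eq_mul]
        refine SemidirectProduct.ext ?_ ?_
        · have h6 : ((j z).right : ℤˣ) = -1 := neg z hz
          rw [SemidirectProduct.mul_left, SemidirectProduct.mul_left, signAction_apply, h6]
          rw [SemidirectProduct.left_inl, SemidirectProduct.left_inl, SemidirectProduct.right_inl,
            map_one, MulAut.one_apply, Units.val_neg, Units.val_one, zpow_neg_one, mul_comm]
        · rw [SemidirectProduct.mul_right, SemidirectProduct.mul_right,
            SemidirectProduct.right_inl, SemidirectProduct.right_inl, mul_one, one_mul]
      rw [mul_assoc, mul_assoc, ← mul_assoc (j z), h5, ← map_inv, ← map_mul]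
    rw [h4] at h3
    obtain ⟨e, he⟩ := h3
    have he1 : ε e = 1 := congrArg (fun x : D' => (x.right : ℤˣ)) he
    have he2 := (hjk ⟨e, he1⟩).symm.trans he
    rw [SemidirectProduct.inl_inj] at he2
    obtain ⟨m, hm, k, hk⟩ := hroot c
    obtain ⟨n, rfl⟩ : ∃ n, m = 2 * n + 1 := ⟨m / 2, by have := two_mem z hz m hm; omega⟩
    have h7 : c = ι (k * ⟨e, he1⟩ ^ n) := by
      rw [map_mul, map_pow, he2, hk, pow_succ, pow_mul, ← mul_inv, inv_pow, ← pow_two]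
      exact (mul_inv_cancel_comm _ _).symm
    rw [hac, h7, ← hjk]
    exact mul_mem ⟨_, rfl⟩ ⟨d, rfl⟩

/-! ### The class `P_π` consists of root-tame groups. -/

theorem mem_centralizerOf {G : Type u} [Group G] {c x : G} : c ∈ centralizerOf x ↔ Commute c x := by
  rw [centralizerOf, Subgroup.mem_centralizer_singleton_iff]; exact Iff.rfl

theorem mem_conjMeetSet {G : Type u} [Group G] {g x : G} :
    g ∈ conjMeetSet x ↔ ∃ c, c ≠ 1 ∧ Commute c x ∧ Commute (g * c * g⁻¹) x := by
  have h1 : ∀ c, c ∈ conjugateSubgroup (centralizerOf x) g ↔ Commute (g * c * g⁻¹) x := by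
    intro c
    rw [conjugateSubgroup, Subgroup.mem_map]
    constructor
    · rintro ⟨b, hb, rfl⟩
      have : g * (MulAut.conj g⁻¹).toMonoidHom b * g⁻¹ = b := by simp [mul_assoc]
      rw [this]
      exact mem_centralizerOf.1 hb
    · intro h
      exact ⟨_, mem_centralizerOf.2 h, by simp [mul_assoc]⟩
  change centralizerOf x ⊓ conjugateSubgroup (centralizerOf x) g ≠ ⊥ ↔ _
  rw [Subgroup.ne_bot_iff_exists_ne_one]
  constructor
  · rintro ⟨⟨c, hc1, hc2⟩, hc⟩
    exact ⟨c, fun h => hc (Subtype.ext h), mem_centralizerOf.1 hc1, (h1 c).1 hc2⟩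
  · rintro ⟨c, hc, hc1, hc2⟩
    exact ⟨⟨c, mem_centralizerOf.2 hc1, (h1 c).2 hc2⟩, fun h => hc (congrArg Subtype.val h)⟩

theorem IsUPi.commute_of_pow {π : Set Nat.Primes} {G : Type*} [Group G] (hG : IsUPi π G) {m : ℕ}
    (hm : IsPrimeToSet π m) {a b : G} (h : Commute (a ^ m) b) : Commute a b := by
  have : b * a * b⁻¹ = a := hG m hm (by simp only [conj_pow, ← h.eq, mul_inv_cancel_right])
  exact (mul_inv_eq_iff_eq_mul.1 this).symm

theorem LacksRoot.ne_one {π : Set Nat.Primes} {G : Type*} [Group G] {x : G} (hx : LacksRoot π x) :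
    x ≠ 1 := by
  rintro rfl
  obtain ⟨m, -, h⟩ := hx
  exact h 1 (one_pow m)

theorem eq_of_zpow_eq_of_torsionFree {G : Type*} [Group G] {x : G}
    (hx : ∀ c, Commute c x → c ≠ 1 → ¬ IsOfFinOrder c) {a b : G} (ha : Commute a x)
    (hb : Commute b x) (hab : Commute a b) {k : ℤ} (hk : k ≠ 0) (h : a ^ k = b ^ k) : a = b := by
  by_contra hne
  refine hx (a * b⁻¹) (ha.mul_left hb.inv_left) (fun h => hne (mul_inv_eq_one.1 h)) ?_
  refine isOfFinOrder_iff_zpow_eq_one.2 ⟨k, hk, ?_⟩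
  rw [hab.inv_right.mul_zpow, inv_zpow, h, mul_inv_cancel]

/-- The centralizer embeds in `ℚ`, so any two of its elements are commensurable and an automorphism
is determined by its effect on `x`. Conjugation by `g` squares to the identity there, so it
multiplies by a rational number of square 1. -/
theorem IsPPi.actsBySign_of_relIndex {π : Set Nat.Primes} {G : Type u} [Group G] {x : G}
    (hx1 : x ≠ 1) (hx : ∀ c, Commute c x → c ≠ 1 → ¬ IsOfFinOrder c) {D : Subgroup G}
    (hCD : centralizerOf x ≤ D) (hD : (centralizerOf x).relIndex D = 2)
    {f : centralizerOf x →* Multiplicative (integersAt π)} (hf : Function.Injective f) {g : G}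
    (hg : g ∈ D) : ActsBySign g x := by
  have hnorm : ((centralizerOf x).subgroupOf D).Normal := Subgroup.normal_of_index_eq_two hD
  have hconj : ∀ c, Commute c x → Commute (g * c * g⁻¹) x := fun c hc => by
    have hc' := mem_centralizerOf.2 hc
    exact mem_centralizerOf.1 (hnorm.conj_mem ⟨c, hCD hc'⟩ hc' ⟨g, hg⟩)
  have hsq : Commute (g ^ 2) x :=
    mem_centralizerOf.1 (Subgroup.sq_mem_of_index_two hD ⟨g, hg⟩)
  have hcomm : ∀ a b, Commute a x → Commute b x → Commute a b := fun a b ha hb => by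
    have : (⟨a, mem_centralizerOf.2 ha⟩ * ⟨b, mem_centralizerOf.2 hb⟩ : centralizerOf x) =
        ⟨b, mem_centralizerOf.2 hb⟩ * ⟨a, mem_centralizerOf.2 ha⟩ :=
      hf (by rw [map_mul, map_mul, mul_comm])
    exact congrArg Subtype.val this
  have rank : ∀ c, Commute c x → ∃ k l : ℤ, k ≠ 0 ∧ c ^ k = x ^ l := fun c hc => by
    let c' : centralizerOf x := ⟨c, mem_centralizerOf.2 hc⟩
    let x' : centralizerOf x := ⟨x, mem_centralizerOf.2 (Commute.refl x)⟩
    let r : ℚ := ((f c').toAdd : integersAt π)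
    let s : ℚ := ((f x').toAdd : integersAt π)
    have hs : s ≠ 0 := fun h => hx1 <| by
      have : f x' = 1 := Subtype.ext h
      exact congrArg Subtype.val (hf (this.trans (map_one f).symm))
    refine ⟨r.den * s.num, r.num * s.den, mul_ne_zero (by simp) (by simpa using hs), ?_⟩
    have : c' ^ ((r.den : ℤ) * s.num) = x' ^ (r.num * s.den) := by
      refine hf (Subtype.ext ?_)
      rw [map_zpow, map_zpow]
      change ((r.den : ℤ) * s.num) • r = (r.num * s.den) • s
      rw [zsmul_eq_mul, zsmul_eq_mul]
      push_cast
      have h1 := Rat.mul_den_eq_num r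
      have h2 := Rat.mul_den_eq_num s
      linear_combination (s.num : ℚ) * h1 - (r.num : ℚ) * h2
    exact congrArg Subtype.val this
  have hinf := injective_zpow_iff_not_isOfFinOrder.2 (hx x (Commute.refl x) hx1)
  have hσx : g * x * g⁻¹ = x ∨ g * x * g⁻¹ = x⁻¹ := by
    have hy := hconj x (Commute.refl x)
    obtain ⟨k, l, hk, hkl⟩ := rank _ hy
    have h1 : g * (g * x * g⁻¹) * g⁻¹ = x := by
      have := mul_inv_eq_iff_eq_mul.2 hsq.eq
      rw [pow_two] at this
      exact Eq.trans (by group) this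
    have h2 : x ^ k = (g * x * g⁻¹) ^ l := by
      rw [conj_zpow, ← hkl, ← conj_zpow, h1]
    have h3 : x ^ (k * k) = x ^ (l * l) := by
      rw [zpow_mul, h2, ← zpow_mul, mul_comm, zpow_mul, hkl, ← zpow_mul]
    rcases mul_self_eq_mul_self_iff.1 (hinf h3) with h | h
    · exact Or.inl (eq_of_zpow_eq_of_torsionFree hx hy (Commute.refl x) hy hk (h ▸ hkl))
    · refine Or.inr (eq_of_zpow_eq_of_torsionFree hx hy (Commute.refl x).inv_left hy.inv_right hk ?_)
      rw [hkl, inv_zpow, h, zpow_neg, inv_inv]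
  rcases hσx with h | h
  · refine Or.inl fun a ha => ?_
    obtain ⟨k, l, hk, hkl⟩ := rank a ha
    refine eq_of_zpow_eq_of_torsionFree hx (hconj a ha) ha (hcomm _ _ (hconj a ha) ha) hk ?_
    rw [conj_zpow, hkl, ← conj_zpow, h]
  · refine Or.inr fun a ha => ?_
    obtain ⟨k, l, hk, hkl⟩ := rank a ha
    refine eq_of_zpow_eq_of_torsionFree hx (hconj a ha) ha.inv_left
      (hcomm _ _ (hconj a ha) ha.inv_left) hk ?_
    rw [conj_zpow, hkl, ← conj_zpow, h, inv_zpow, inv_zpow, hkl]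

/-- The point is that a `g` commuting with `x` centralizes all of `C_G(x)`. Suppose it does not
commute with `y` in `C_G(x)`. If `y` lacked a root, `g` would act by sign on `C_G(y)`, which
contains `x`, and so would invert `x`; but `g` fixes `x`, which has infinite order. Hence `y`, and
likewise `x * y`, has all `π'`-roots, and the quotient of their `m`-th roots is an `m`-th root of
`x`. -/
theorem IsPPi.isRootTame {π : Set Nat.Primes} {G : Type u} [Group G] (hG : IsPPi π G) :
    IsRootTame π G := by
  have tf : ∀ x : G, LacksRoot π x → ∀ c, Commute c x → c ≠ 1 → ¬ IsOfFinOrder c :=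
    fun x hx c hc => (hG.centralizer_cond x hx).1 c (mem_centralizerOf.2 hc)
  have alt : ∀ x : G, LacksRoot π x → ∀ g ∈ conjMeetSet x, Commute g x ∨ ActsBySign g x := by
    intro x hx g hg
    rcases (hG.centralizer_cond x hx).2 with h | ⟨⟨D, hD, hCD, hi⟩, f, hf⟩
    · rw [h] at hg
      exact Or.inl (mem_centralizerOf.1 hg)
    · rw [← hD] at hg
      exact Or.inr (IsPPi.actsBySign_of_relIndex hx.ne_one (tf x hx) hCD hi hf hg)
  refine ⟨hG.isUPi, fun x hx => ⟨tf x hx, fun g c hc hc1 hgc => ?_⟩⟩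
  refine (alt x hx g (mem_conjMeetSet.2 ⟨c, hc1, hc, hgc⟩)).elim (fun hgx => Or.inl fun y hy => ?_) id
  rw [mul_inv_eq_iff_eq_mul]
  by_contra hgy
  have noncentral : ∀ y, Commute y x → ¬ Commute g y → ¬ LacksRoot π y := fun y hy hgy hly => by
    have hmem : g ∈ conjMeetSet y := mem_conjMeetSet.2 ⟨x, hx.ne_one, hy.symm, by
      rw [hgx.eq, mul_inv_cancel_right]; exact hy.symm⟩
    refine (alt y hly g hmem).elim hgy fun h => ?_
    rcases h with h | h
    · exact hgy (mul_inv_eq_iff_eq_mul.1 (h y (Commute.refl y)))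
    · have h1 := h x hy.symm
      rw [hgx.eq, mul_inv_cancel_right] at h1
      refine tf x hx x (Commute.refl x) hx.ne_one (isOfFinOrder_iff_pow_eq_one.2 ⟨2, two_pos, ?_⟩)
      rw [pow_two]
      nth_rw 2 [h1]
      exact mul_inv_cancel x
  have root : ∀ y, Commute y x → ¬ Commute g y → ∀ m, IsPrimeToSet π m → ∃ a, a ^ m = y :=
    fun y hy hgy m hm => by
      by_contra! h
      exact noncentral y hy hgy ⟨m, hm, h⟩
  obtain ⟨m, hm, hxm⟩ := id hx
  obtain ⟨a, ha⟩ := root y hy hgy m hm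
  obtain ⟨b, hb⟩ := root (x * y) ((Commute.refl x).mul_left hy)
    (fun h => hgy (show Commute g y by simpa using hgx.inv_right.mul_right h)) m hm
  have hax : Commute a x := hG.isUPi.commute_of_pow hm (by rwa [ha])
  have hba : Commute b a := hG.isUPi.commute_of_pow hm (by
    rw [hb, ← ha]; exact (hax.mul_right (Commute.self_pow a m)).symm)
  refine hxm (b * a⁻¹) ?_
  rw [hba.inv_right.mul_pow, inv_pow, ha, hb, mul_inv_cancel_right]

/-! ### Transfer of tameness and the sign subgroup. -/

section Transfer

variable {G H : Type*} [Group G] [Group H] {x : G}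

theorem IsTameAt.of_mulEquiv (e : G ≃* H) (h : IsTameAt (e x)) : IsTameAt x := by
  have hc : ∀ {c}, Commute c x → Commute (e c) (e x) := fun hc => hc.map e
  refine ⟨fun c hcx hc1 hfin => ?_, fun g c hcx hc1 hgc => ?_⟩
  · exact h.torsionFree (e c) (hc hcx) (by simpa using hc1) (e.toMonoidHom.isOfFinOrder hfin)
  · have h1 := h.actsBySign (e g) (e c) (hc hcx) (by simpa using hc1)
      (by simpa only [map_mul, map_inv] using hc hgc)
    refine h1.imp (fun h a ha => e.injective ?_) (fun h a ha => e.injective ?_)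
    · simpa only [map_mul, map_inv] using h (e a) (hc ha)
    · simpa only [map_mul, map_inv] using h (e a) (hc ha)

theorem IsTameAt.of_conj {h : G} (hx : IsTameAt (h⁻¹ * x * h)) : IsTameAt x := by
  refine IsTameAt.of_mulEquiv (MulAut.conj h⁻¹) ?_
  rwa [MulAut.conj_apply, inv_inv]

/-- Tameness passes to a larger group that contains the centralizer of `x` and whatever conjugates
one of its nontrivial elements into it. -/
theorem IsTameAt.map {f : G →* H} (hf : Function.Injective f) (hx : IsTameAt x)
    (hcent : ∀ w, Commute w (f x) → w ∈ f.range)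
    (hconj : ∀ g c, Commute c x → c ≠ 1 → Commute (g * f c * g⁻¹) (f x) → g ∈ f.range) :
    IsTameAt (f x) := by
  have back : ∀ {a}, Commute (f a) (f x) → Commute a x := fun {a} h =>
    hf (by simpa only [map_mul] using h.eq)
  refine ⟨fun w hw hw1 => ?_, fun g w hw hw1 hgw => ?_⟩
  · obtain ⟨c, rfl⟩ := hcent w hw
    rw [hf.isOfFinOrder_iff]
    exact hx.torsionFree c (back hw) fun h => hw1 (by rw [h, map_one])
  · obtain ⟨c, rfl⟩ := hcent w hw
    have hc1 : c ≠ 1 := fun h => hw1 (by rw [h, map_one])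
    obtain ⟨g, rfl⟩ := hconj g c (back hw) hc1 hgw
    refine (hx.actsBySign g c (back hw) hc1 (back (by simpa only [map_mul, map_inv] using hgw))).imp
      (fun h w hw => ?_) (fun h w hw => ?_)
    · obtain ⟨a, rfl⟩ := hcent w hw
      rw [← map_inv, ← map_mul, ← map_mul, h a (back hw)]
    · obtain ⟨a, rfl⟩ := hcent w hw
      rw [← map_inv, ← map_mul, ← map_mul, h a (back hw), map_inv]

theorem ActsBySign.inv {g : G} (hg : ActsBySign g x) : ActsBySign g⁻¹ x := by
  have key : ∀ a b, g * a * g⁻¹ = b → g⁻¹ * b * g⁻¹⁻¹ = a := fun a b h => by rw [← h]; group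
  refine hg.imp (fun h a ha => key _ _ (h a ha)) (fun h a ha => key _ _ ?_)
  rw [h a⁻¹ ha.inv_left, inv_inv]

theorem ActsBySign.mul {g k : G} (hg : ActsBySign g x) (hk : ActsBySign k x) :
    ActsBySign (g * k) x := by
  have key : ∀ a b c, k * a * k⁻¹ = b → g * b * g⁻¹ = c → g * k * a * (g * k)⁻¹ = c :=
    fun a b c h h' => by rw [← h', ← h]; group
  rcases hk with h | h <;> rcases hg with h' | h'
  · exact Or.inl fun a ha => key _ _ _ (h a ha) (h' a ha)
  · exact Or.inr fun a ha => key _ _ _ (h a ha) (h' a ha)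
  · exact Or.inr fun a ha => key _ _ _ (h a ha) (h' _ ha.inv_left)
  · exact Or.inl fun a ha => key _ _ _ (h a ha) (by rw [h' _ ha.inv_left, inv_inv])

/-- The subgroup of the elements that act by sign on the centralizer of `x`. -/
def signSubgroup (x : G) : Subgroup G where
  carrier := {g | ActsBySign g x}
  one_mem' := Or.inl fun a _ => by group
  mul_mem' := ActsBySign.mul
  inv_mem' := ActsBySign.inv

theorem mem_signSubgroup {g : G} : g ∈ signSubgroup x ↔ ActsBySign g x := Iff.rfl

/-- The sign with which an element acts. -/
theorem exists_sign (x : G) :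
    ∃ ε : signSubgroup x →* ℤˣ, ∀ d : signSubgroup x, ε d = 1 ↔ Commute (d : G) x := by
  classical
  have neg : ∀ d : signSubgroup x, ¬ Commute (d : G) x → ∀ a, Commute a x →
      (d : G) * a * (d : G)⁻¹ = a⁻¹ := fun d hd a ha => by
    rcases d.2 with h | h
    · exact absurd (mul_inv_eq_iff_eq_mul.1 (h x (Commute.refl x))) hd
    · exact h a ha
  have hcomm : ∀ d e : signSubgroup x, (Commute ((d * e : signSubgroup x) : G) x) ↔
      (Commute (d : G) x ↔ Commute (e : G) x) := fun d e => by
    rw [Subgroup.coe_mul]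
    by_cases hd : Commute (d : G) x <;> by_cases he : Commute (e : G) x
    · simp [hd, he, hd.mul_left he]
    · refine iff_of_false (fun h => he ?_) (by simp [hd, he])
      simpa using hd.inv_left.mul_left h
    · refine iff_of_false (fun h => hd ?_) (by simp [hd, he])
      simpa using h.mul_left he.inv_left
    · refine iff_of_true (mul_inv_eq_iff_eq_mul.1 ?_) (by simp [hd, he])
      have h1 := neg d hd x⁻¹ (Commute.refl x).inv_left
      rw [inv_inv, ← neg e he x (Commute.refl x)] at h1
      exact Eq.trans (by group) h1
  refine ⟨{ toFun := fun d => if Commute (d : G) x then 1 else -1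
            map_one' := if_pos (Commute.one_left x)
            map_mul' := fun d e => ?_ }, fun d => ?_⟩
  · rw [hcomm]
    by_cases hd : Commute (d : G) x <;> by_cases he : Commute (e : G) x <;> simp [hd, he]
  · change (if Commute (d : G) x then (1 : ℤˣ) else -1) = 1 ↔ _
    by_cases hd : Commute (d : G) x
    · simp [hd]
    · rw [if_neg hd]
      exact iff_of_false (by decide) hd

/-- The square of `g` centralizes `x`, so `g` inverts it while commuting with it. Thus `g ^ 4 = 1`,
and torsion-freeness gives the claim. -/
theorem IsTameAt.sq_eq_one (hx : IsTameAt x) {g : G}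
    (hg : ActsBySign g x) (hgx : ¬ Commute g x) : g ^ 2 = 1 := by
  have neg : ∀ a, Commute a x → g * a * g⁻¹ = a⁻¹ := by
    rcases hg with h | h
    · exact absurd (mul_inv_eq_iff_eq_mul.1 (h x (Commute.refl x))) hgx
    · exact h
  have h1 : Commute (g ^ 2) x := by
    have h2 := neg x⁻¹ (Commute.refl x).inv_left
    rw [inv_inv, ← neg x (Commute.refl x)] at h2
    refine mul_inv_eq_iff_eq_mul.1 (Eq.trans ?_ h2)
    rw [pow_two]; group
  by_contra h
  refine hx.torsionFree _ h1 h (isOfFinOrder_iff_pow_eq_one.2 ⟨2, two_pos, ?_⟩)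
  have h2 := neg _ h1
  rw [(Commute.self_pow g 2).eq, mul_inv_cancel_right] at h2
  rw [pow_two (g ^ 2)]
  nth_rw 2 [h2]
  exact mul_inv_cancel _

end Transfer

/-! ### Adjoining roots. -/

/-- A vertex of the coset tree that is not fixed by conjugates from the other side is the only
fixed vertex. -/
theorem IsAcylindrical.eq_of_smul_eq {Γ : Type*} [Group Γ] {P : Bool → Subgroup Γ}
    (h : IsAcylindrical Γ (cosetGraph P).dist) {z : Γ} {b : Bool} (hz : z ∈ P b)
    (hzP : ∀ k ∈ P b, k⁻¹ * z * k ∉ P (!b)) {v : Σ b, Γ ⧸ P b} (hv : z • v = v) :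
    v = cosetVertex P b 1 := by
  have hz1 : z • cosetVertex P b 1 = cosetVertex P b 1 := by
    rw [smul_cosetVertex_eq_iff]; simpa using hz
  by_contra hne
  have hpos : 1 ≤ (cosetGraph P).dist (cosetVertex P b 1) v :=
    Nat.pos_of_ne_zero fun h0 => hne (h.eq_of_zero _ _ h0).symm
  obtain ⟨w, hw1, hw2⟩ := h.between _ _ 1 hpos
  have hzw := h.smul_eq_of_between hz1 hv (v := w) (by omega)
  rw [SimpleGraph.dist_eq_one_iff_adj] at hw1
  obtain ⟨c, k, hk1, rfl⟩ := hw1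
  obtain rfl : b = c := congrArg Sigma.fst hk1
  rw [cosetVertex_eq_iff, inv_one, one_mul] at hk1
  exact hzP k hk1 (smul_cosetVertex_eq_iff.1 hzw)

/-- In a root-tame group, a root can be adjoined to any element that lacks one. -/
theorem IsRootTame.exists_extension {π : Set Nat.Primes} {K : Type u} [Group K]
    (hK : IsRootTame π K) {x : K} (hx : LacksRoot π x) :
    ∃ (Γ : Type u) (_ : Group Γ) (f : K →* Γ), Function.Injective f ∧ IsRootTame π Γ ∧
      (∀ m, IsPrimeToSet π m → ∃ y, y ^ m = f x) ∧
      (∀ S : Subgroup Γ, f.range ≤ S →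
        (∀ y m, IsPrimeToSet π m → y ^ m ∈ f.range → y ∈ S) → S = ⊤) ∧
      (Group.IsSolvable Γ → Group.IsVirtuallyNilpotent K) := by
  have htx := hK.isTameAt x hx
  have hxinf := htx.torsionFree x (Commute.refl x) hx.ne_one
  obtain ⟨ε, hε⟩ := exists_sign x
  have inv : ∀ d : K, ActsBySign d x → ¬ Commute d x → d ^ 2 = 1 := fun d hd hdx =>
    htx.sq_eq_one hd hdx
  obtain ⟨D', _, j, hj, hD', hgen, hmal⟩ := exists_dihedral_localization (π := π) ε
    (fun a b ha hb => Subtype.ext (a.2.commute ((hε a).1 ha) hxinf ((hε b).1 hb)))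
    (hK.isUPi.of_injective (signSubgroup x).subtype_injective)
    (fun d hd => Subtype.ext (inv d d.2 fun h => hd ((hε d).2 h)))
  -- `Γ` amalgamates `K` with the localization `D'` of the sign subgroup of `x`, along that
  -- subgroup.
  obtain ⟨Γ, _, f, g, P, hf, hg, hfg, hPt, hPf, hP, hPi⟩ :=
    exists_isAmalgam (signSubgroup x).subtype j (signSubgroup x).subtype_injective hj
  have memD : ∀ {k}, f k ∈ P false ↔ k ∈ signSubgroup x := fun {k} => by
    refine ⟨fun h => ?_, fun h => ?_⟩
    · obtain ⟨d, hd⟩ := hPi (f k) fun b => by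
        cases b with
        | true => rw [hPt]; exact ⟨k, rfl⟩
        | false => exact h
      rw [hf hd]; exact d.2
    · rw [hPf]; exact ⟨j ⟨k, h⟩, (hfg ⟨k, h⟩).symm⟩
  have memj : ∀ {a}, g a ∈ P true → a ∈ j.range := fun {a} h => by
    obtain ⟨d, hd⟩ := hPi (g a) fun b => by
      cases b with
      | true => exact h
      | false => rw [hPf]; exact ⟨a, rfl⟩
    exact ⟨d, hg ((hfg d).symm.trans hd.symm)⟩
  have conjD : ∀ {d k : K}, d ≠ 1 → Commute d x → k⁻¹ * d * k ∈ signSubgroup x →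
      k ∈ signSubgroup x := fun {d k} hd1 hd hk => by
    by_cases hc : Commute (k⁻¹ * d * k) x
    · have := htx.actsBySign k⁻¹ d hd hd1 (by rwa [inv_inv])
      exact inv_mem_iff.1 (mem_signSubgroup.2 this)
    · refine absurd (isOfFinOrder_iff_pow_eq_one.2 ⟨2, two_pos, ?_⟩) (htx.torsionFree d hd hd1)
      have h2 := inv _ hk hc
      have h3 := conj_pow (a := k⁻¹) (b := d) (i := 2)
      rw [inv_inv, h2, eq_comm, ← inv_inv k, inv_inv k⁻¹, conj_eq_one_iff] at h3
      exact h3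
  have hac := cosetGraph.isAcylindrical hP (by
    intro z hz k hk hk' hzk
    obtain ⟨d, rfl⟩ := hPi z hz
    have h1 := hk true
    have h2 := hk false
    rw [hPt] at h1
    rw [hPf] at h2
    obtain ⟨k₁, hk₁⟩ := h1
    obtain ⟨a, ha⟩ := h2
    -- Elements of sign `1` are excluded on the `K` side by `conjD`, those of sign `-1` on the `D'`
    -- side by `hmal`.
    by_cases hd : ε d = 1
    · by_contra hd1
      refine hk' true ?_
      rw [← hk₁, Bool.not_true, memD]
      refine conjD (d := d) (fun h => hd1 ?_) ((hε d).1 hd) (memD.1 ?_)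
      · rw [Subgroup.subtype_apply, h, map_one]
      · rw [map_mul, map_mul, map_inv, hk₁]
        exact hzk true
    · exfalso
      have h3 := hzk false
      rw [← ha, hfg, ← map_inv, ← map_mul, ← map_mul] at h3
      obtain ⟨e, rfl⟩ := hmal d hd a (memj h3)
      exact hk' false (ha ▸ hfg e ▸ hPt ▸ ⟨_, rfl⟩))
  have hne : Nonempty (Σ b, Γ ⧸ P b) := ⟨cosetVertex P true 1⟩
  have rootg : ∀ a m, IsPrimeToSet π m → ∃ y, y ^ m = g a := fun a m hm => by
    obtain ⟨b, hb⟩ := (hD'.bijective_pow hm).2 a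
    exact ⟨g b, by rw [← map_pow]; exact congrArg g hb⟩
  have rootconj : ∀ (y h : Γ), LacksRoot π y → LacksRoot π (h⁻¹ * y * h) := by
    rintro y h ⟨m, hm, hy⟩
    refine ⟨m, hm, fun w hw => hy (h * w * h⁻¹) ?_⟩
    rw [conj_pow, hw]; group
  have noroot : ∀ y ∈ P false, ¬ LacksRoot π y := fun y hy ⟨m, hm, h⟩ => by
    rw [hPf] at hy
    obtain ⟨a, rfl⟩ := hy
    obtain ⟨w, hw⟩ := rootg a m hm
    exact h w hw
  have stab : ∀ b, IsUPi π (P b) := fun b => by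
    cases b with
    | true =>
      rw [hPt]
      exact hK.isUPi.of_injective (MonoidHom.ofInjective hf).symm.injective
        (f := (MonoidHom.ofInjective hf).symm.toMonoidHom)
    | false =>
      rw [hPf]
      exact hD'.isUPi.of_injective (MonoidHom.ofInjective hg).symm.injective
        (f := (MonoidHom.ofInjective hg).symm.toMonoidHom)
  have tameK : ∀ k, LacksRoot π (f k) → IsTameAt (f k) := by
    intro k hk
    have hkK : LacksRoot π k := by
      obtain ⟨m, hm, h⟩ := hk
      exact ⟨m, hm, fun y hy => h (f y) (by rw [← map_pow, hy])⟩
    have htk := hK.isTameAt k hkK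
    -- A conjugate of `k` in the sign subgroup would acquire all its roots in `D'`. By tameness at
    -- `x` the same exclusion extends to nontrivial `c` commuting with `k`; such `c` fix only the
    -- base vertex, so the relevant centralizing and conjugating elements fix it too and lie in `K`.
    have notD : ∀ b, b⁻¹ * k * b ∉ signSubgroup x := fun b hb => by
      refine noroot _ (memD.2 hb) ?_
      rw [map_mul, map_mul, map_inv]
      exact rootconj _ _ hk
    have notD' : ∀ c, Commute c k → c ≠ 1 → ∀ b, b⁻¹ * c * b ∉ signSubgroup x :=
      fun c hc hc1 b hb => by
        have hb1 : b⁻¹ * c * b ≠ 1 := fun h => hc1 <| by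
          have := congrArg (fun w => b * w * b⁻¹) h
          simpa [mul_assoc] using this
        by_cases hcx : Commute (b⁻¹ * c * b) x
        · refine notD b (htx.actsBySign _ _ hcx hb1 ?_)
          have h1 : Commute (b⁻¹ * k * b) (b⁻¹ * c * b) := by
            have := hc.symm.map (MulAut.conj b⁻¹)
            simpa using this
          rwa [h1.eq, mul_inv_cancel_right]
        · refine htk.torsionFree c hc hc1 (isOfFinOrder_iff_pow_eq_one.2 ⟨2, two_pos, ?_⟩)
          have h2 := inv _ hb hcx
          have h3 := congrArg (fun w => b * w * b⁻¹) h2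
          rw [pow_two] at h3
          rw [pow_two]
          simpa [mul_assoc] using h3
    have only : ∀ c, Commute c k → c ≠ 1 → ∀ w : Γ,
        f c • w • cosetVertex P true 1 = w • cosetVertex P true 1 → w ∈ f.range := by
      intro c hc hc1 w hw
      have h1 := hac.eq_of_smul_eq (z := f c) (b := true) (by rw [hPt]; exact ⟨c, rfl⟩)
        (fun a ha => ?_) hw
      · rw [smul_cosetVertex, mul_one, cosetVertex_eq_iff, mul_one, hPt] at h1
        exact inv_mem_iff.1 h1
      · rw [hPt] at ha
        obtain ⟨b, rfl⟩ := ha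
        rw [Bool.not_true, ← map_inv, ← map_mul, ← map_mul, memD]
        exact notD' c hc hc1 b
    have fixbase : ∀ a, f a • cosetVertex P true 1 = cosetVertex P true 1 := fun a => by
      rw [smul_cosetVertex_eq_iff, hPt]
      exact ⟨a, by group⟩
    have cent : ∀ w, Commute w (f k) → w ∈ f.range := fun w hw =>
      only k (Commute.refl k) hkK.ne_one w (by rw [smul_smul, ← hw.eq, mul_smul, fixbase])
    refine htk.map hf cent fun w c hc hc1 hwc => ?_
    obtain ⟨c', hc'⟩ := cent _ hwc
    refine inv_mem_iff.1 (only c hc hc1 w⁻¹ ?_)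
    have h1 : f c = w⁻¹ * f c' * w := by rw [hc']; group
    rw [h1, mul_smul, smul_inv_smul, mul_smul, fixbase]
  refine ⟨Γ, inferInstance, f, hf, ⟨fun m hm => hac.pow_injective hm.1 ?_, fun y hy => ?_⟩, ?_, ?_, ?_⟩
  · intro v a b ha hb hab
    obtain ⟨c, h, rfl⟩ := exists_cosetVertex v
    rw [smul_cosetVertex_eq_iff] at ha hb
    have h1 : (⟨h⁻¹ * a * h, ha⟩ : P c) = ⟨h⁻¹ * b * h, hb⟩ := by
      refine stab c m hm (Subtype.ext ?_)
      change (h⁻¹ * a * h) ^ m = (h⁻¹ * b * h) ^ m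
      have h2 : ∀ a : Γ, (h⁻¹ * a * h) ^ m = h⁻¹ * a ^ m * h := fun a => by
        have := conj_pow (a := h⁻¹) (b := a) (i := m)
        rwa [inv_inv] at this
      rw [h2, h2, hab]
    simpa using congrArg Subtype.val h1
  · by_cases hfix : ∃ v : Σ b, Γ ⧸ P b, y • v = v
    · obtain ⟨v, hv⟩ := hfix
      obtain ⟨b, h, rfl⟩ := exists_cosetVertex v
      rw [smul_cosetVertex_eq_iff] at hv
      have hyh := rootconj y h hy
      cases b with
      | false => exact absurd hyh (noroot _ hv)
      | true =>
        rw [hPt] at hv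
        obtain ⟨k, hk⟩ := hv
        exact IsTameAt.of_conj (h := h) (hk ▸ tameK k (hk ▸ hyh))
    · push Not at hfix
      exact ⟨fun c hc hc1 => hac.not_isOfFinOrder hfix hc hc1,
        fun w c hc hc1 hwc => hac.actsBySign hfix hc hc1 hwc⟩
  · intro m hm
    have : ActsBySign x x := Or.inl fun a ha => by rw [← ha.eq, mul_inv_cancel_right]
    obtain ⟨y, hy⟩ := rootg (j ⟨x, this⟩) m hm
    exact ⟨y, hy.trans (hfg _).symm⟩
  · intro S hS hroot
    rw [eq_top_iff, ← hP.closure_eq, Subgroup.closure_le, hPt, hPf]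
    rintro _ (hw | ⟨a, rfl⟩)
    · exact hS hw
    · obtain ⟨c, d, rfl, m, hm, k, -, hk⟩ := hgen a
      rw [map_mul]
      refine mul_mem (hroot _ m hm ?_) (hS ⟨_, hfg d⟩)
      rw [← map_pow, hk]
      exact ⟨_, hfg k⟩
  · intro hsol
    rcases hac.fixes_or_actsBySign hsol with ⟨v, hv⟩ | ⟨y, hy, hys⟩
    -- A fixed vertex makes `Γ` equal to a factor. It is not `K`, where `x` lacks a root; if it is
    -- `D'`, then all of `K` acts by sign on the centralizer of `x`.
    · obtain ⟨b, h, rfl⟩ := exists_cosetVertex v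
      have hall : ∀ w : Γ, w ∈ P b := fun w => by
        have := smul_cosetVertex_eq_iff.1 (hv (h * w * h⁻¹))
        simpa [mul_assoc] using this
      cases b with
      | true =>
        exfalso
        obtain ⟨m, hm, hxm⟩ := hx
        have hsx : ActsBySign x x := Or.inl fun a ha => by rw [← ha.eq, mul_inv_cancel_right]
        obtain ⟨y, hy⟩ := rootg (j ⟨x, hsx⟩) m hm
        have h1 := hall y
        rw [hPt] at h1
        obtain ⟨w, rfl⟩ := h1
        refine hxm w (hf ?_)
        rw [map_pow, hy]
        exact (hfg ⟨x, hsx⟩).symm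
      | false =>
        exact isVirtuallyNilpotent_of_actsBySign (ι := MonoidHom.id K) Function.injective_id hxinf
          fun k => memD.1 (hall (f k))
    · exact isVirtuallyNilpotent_of_actsBySign hf hy fun k => hys (f k)

/-! ### Embedding root-tame groups in `π`-local groups. -/

/-- `w.Evaluates θ k`: the formal word `w` has the value `k`. -/
inductive RootWord.Evaluates {π : Set Nat.Primes} {G K : Type u} [Group G] [Group K] (θ : G →* K) :
    RootWord π G → K → Prop
  | of (g : G) : Evaluates θ (.of g) (θ g)
  | one : Evaluates θ .one 1
  | mul (a b : RootWord π G) (x y : K) : Evaluates θ a x → Evaluates θ b y →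
      Evaluates θ (.mul a b) (x * y)
  | inv (a : RootWord π G) (x : K) : Evaluates θ a x → Evaluates θ (.inv a) x⁻¹
  | root (q : Nat.Primes) (hq : q ∉ π) (a : RootWord π G) (x : K) : Evaluates θ a (x ^ (q : ℕ)) →
      Evaluates θ (.root q hq a) x

namespace RootWord.Evaluates

variable {π : Set Nat.Primes} {G K : Type u} [Group G] [Group K] {θ : G →* K}

theorem unique (hK : IsUPi π K) {w : RootWord π G} {x y : K} (hx : w.Evaluates θ x)
    (hy : w.Evaluates θ y) : x = y := by
  induction hx generalizing y with
  | of g => cases hy; rfl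
  | one => cases hy; rfl
  | mul a b x₁ x₂ _ _ ih₁ ih₂ =>
    cases hy with
    | mul _ _ y₁ y₂ h₁ h₂ => rw [ih₁ h₁, ih₂ h₂]
  | inv a x _ ih =>
    cases hy with
    | inv _ y h => rw [ih h]
  | root q hq a x _ ih =>
    cases hy with
    | root _ _ _ y h => exact hK q (isPrimeToSet_prime hq) (ih h)

theorem map {K' : Type u} [Group K'] (f : K →* K') {w : RootWord π G} {x : K}
    (hx : w.Evaluates θ x) : w.Evaluates (f.comp θ) (f x) := by
  induction hx with
  | of g => exact .of g
  | one => rw [map_one]; exact .one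
  | mul a b x y _ _ ih₁ ih₂ => rw [map_mul]; exact .mul a b _ _ ih₁ ih₂
  | inv a x _ ih => rw [map_inv]; exact .inv a _ ih
  | root q hq a x _ ih => exact .root q hq a _ (by rwa [map_pow] at ih)

end RootWord.Evaluates

namespace IsRootTame

variable {π : Set Nat.Primes} {G : Type u} [Group G]

/-- Each missing root met while evaluating the word is adjoined by `exists_extension`; the group
varies in the induction because it grows from one subword to the next. -/
theorem exists_evaluates (w : RootWord π G) {K : Type u} [Group K] (hK : IsRootTame π K)
    (θ : G →* K) :
    ∃ (K' : Type u) (_ : Group K') (f : K →* K'), Function.Injective f ∧ IsRootTame π K' ∧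
      ∃ x, w.Evaluates (f.comp θ) x := by
  induction w generalizing K with
  | of g => exact ⟨K, _, MonoidHom.id K, Function.injective_id, hK, _, .of g⟩
  | one => exact ⟨K, _, MonoidHom.id K, Function.injective_id, hK, _, .one⟩
  | mul a b iha ihb =>
    obtain ⟨K₁, _, f₁, hf₁, hK₁, x, hx⟩ := iha hK θ
    obtain ⟨K₂, _, f₂, hf₂, hK₂, y, hy⟩ := ihb hK₁ (f₁.comp θ)
    exact ⟨K₂, _, f₂.comp f₁, hf₂.comp hf₁, hK₂, _, .mul a b _ _ (hx.map f₂) hy⟩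
  | inv a ih =>
    obtain ⟨K₁, _, f₁, hf₁, hK₁, x, hx⟩ := ih hK θ
    exact ⟨K₁, _, f₁, hf₁, hK₁, _, .inv a x hx⟩
  | root q hq a ih =>
    obtain ⟨K₁, _, f₁, hf₁, hK₁, x, hx⟩ := ih hK θ
    have hq' := isPrimeToSet_prime hq
    by_cases hlack : LacksRoot π x
    · obtain ⟨K₂, _, f₂, hf₂, hK₂, hroot, -⟩ := hK₁.exists_extension hlack
      obtain ⟨y, hy⟩ := hroot q hq'
      exact ⟨K₂, _, f₂.comp f₁, hf₂.comp hf₁, hK₂, y, .root q hq a y (hy ▸ hx.map f₂)⟩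
    · obtain ⟨y, hy⟩ : ∃ y, y ^ (q : ℕ) = x := by
        by_contra! h
        exact hlack ⟨q, hq', h⟩
      exact ⟨K₁, _, f₁, hf₁, hK₁, y, .root q hq a y (hy ▸ hx)⟩

theorem exists_evaluates_finset (hG : IsRootTame π G) (F : Finset (RootWord π G)) :
    ∃ (K : Type u) (_ : Group K) (θ : G →* K), Function.Injective θ ∧ IsRootTame π K ∧
      ∀ w ∈ F, ∃ x, w.Evaluates θ x := by
  classical
  induction F using Finset.induction_on with
  | empty => exact ⟨G, _, MonoidHom.id G, Function.injective_id, hG, by simp⟩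
  | insert w F _ ih =>
    obtain ⟨K₁, _, θ, hθ, hK₁, hF⟩ := ih
    obtain ⟨K₂, _, f, hf, hK₂, hw⟩ := exists_evaluates w hK₁ θ
    refine ⟨K₂, _, f.comp θ, hf.comp hθ, hK₂, fun v hv => ?_⟩
    rcases Finset.mem_insert.1 hv with rfl | hv
    · exact hw
    · obtain ⟨x, hx⟩ := hF v hv
      exact ⟨_, hx.map f⟩

/-- A root-tame group embeds in a `π`-local group: the values of the formal words in a reduced
product of root-tame groups in which finitely many words have values. -/
theorem exists_isPiLocal (hG : IsRootTame π G) :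
    ∃ (L : Type u) (_ : Group L) (f : G →* L), Function.Injective f ∧ IsPiLocal π L := by
  classical
  choose K _ θ hθ hK hev using hG.exists_evaluates_finset
  let N : Subgroup (∀ F, K F) :=
    { carrier := {f | ∀ᶠ F in Filter.atTop, f F = 1}
      one_mem' := Filter.Eventually.of_forall fun _ => rfl
      mul_mem' := fun {a b} ha hb => by
        filter_upwards [ha, hb] with F h1 h2
        rw [Pi.mul_apply, h1, h2, mul_one]
      inv_mem' := fun {a} ha => by
        filter_upwards [ha] with F h1
        rw [Pi.inv_apply, h1, inv_one] }
  have hN : N.Normal := ⟨fun a ha g => by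
    filter_upwards [show ∀ᶠ F in Filter.atTop, a F = 1 from ha] with F h1
    rw [Pi.mul_apply, Pi.mul_apply, Pi.inv_apply, h1, mul_one, mul_inv_cancel]⟩
  let mk : (∀ F, K F) →* (∀ F, K F) ⧸ N := QuotientGroup.mk' N
  have mk_eq : ∀ a b, mk a = mk b ↔ ∀ᶠ F in Filter.atTop, a F = b F := fun a b => by
    refine QuotientGroup.eq.trans (Filter.eventually_congr (Filter.Eventually.of_forall fun F => ?_))
    rw [Pi.mul_apply, Pi.inv_apply, inv_mul_eq_one]
  -- The default `1` is used only where `w` has no value, which does not happen once `w ∈ F`.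
  let val : RootWord π G → ∀ F, K F := fun w F =>
    if h : ∃ x, w.Evaluates (θ F) x then h.choose else 1
  have hval : ∀ w : RootWord π G, ∀ᶠ F in Filter.atTop, w.Evaluates (θ F) (val w F) := fun w => by
    filter_upwards [Filter.eventually_ge_atTop {w}] with F hF
    have h := hev F w (Finset.singleton_subset_iff.1 hF)
    simp only [val, dif_pos h]
    exact h.choose_spec
  have val_eq : ∀ (w : RootWord π G) (a : ∀ F, K F),
      (∀ᶠ F in Filter.atTop, w.Evaluates (θ F) (a F)) → mk (val w) = mk a := fun w a ha => by
    rw [mk_eq]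
    filter_upwards [hval w, ha] with F h1 h2
    exact h1.unique (hK F).isUPi h2
  -- Restricting to values of words makes roots available: the word `.root q hq w` provides one for
  -- `w`. Their uniqueness is inherited from the groups `K F`.
  let L : Subgroup ((∀ F, K F) ⧸ N) :=
    { carrier := Set.range fun w => mk (val w)
      one_mem' := ⟨.one, val_eq _ 1 (Filter.Eventually.of_forall fun _ => .one)⟩
      mul_mem' := by
        rintro _ _ ⟨v, rfl⟩ ⟨w, rfl⟩
        refine ⟨.mul v w, (val_eq _ (val v * val w) ?_).trans (map_mul mk _ _)⟩
        filter_upwards [hval v, hval w] with F h1 h2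
        exact .mul _ _ _ _ h1 h2
      inv_mem' := by
        rintro _ ⟨v, rfl⟩
        refine ⟨.inv v, (val_eq _ (val v)⁻¹ ?_).trans (map_inv mk _)⟩
        filter_upwards [hval v] with F h1
        exact .inv _ _ h1 }
  let δ : G →* ∀ F, K F := MonoidHom.pi θ
  let f : G →* L := (mk.comp δ).codRestrict L fun g =>
    ⟨.of g, val_eq _ (δ g) (Filter.Eventually.of_forall fun _ => .of g)⟩
  refine ⟨L, inferInstance, f, fun g h hgh => ?_, fun q hq => ⟨?_, ?_⟩⟩
  · obtain ⟨F, hF⟩ := ((mk_eq _ _).1 (congrArg Subtype.val hgh)).exists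
    exact hθ F hF
  · rintro ⟨_, v, rfl⟩ ⟨_, w, rfl⟩ hvw
    have h1 : mk (val v ^ (q : ℕ)) = mk (val w ^ (q : ℕ)) := by
      rw [map_pow, map_pow]
      exact congrArg Subtype.val hvw
    rw [mk_eq] at h1
    refine Subtype.ext ((mk_eq _ _).2 ?_)
    filter_upwards [h1] with F hF
    exact (hK F).isUPi q (isPrimeToSet_prime hq) hF
  · rintro ⟨_, w, rfl⟩
    refine ⟨⟨_, .root q hq w, rfl⟩, Subtype.ext ?_⟩
    refine Eq.trans (map_pow mk _ _).symm (val_eq w _ ?_).symm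
    filter_upwards [hval (.root q hq w)] with F hF
    cases hF with
    | root _ _ _ _ h => exact h

end IsRootTame

/-! ### Conclusion. -/

theorem theorem2p6 (π : Set Nat.Primes) (hπ : π ≠ Set.univ) (G : Type u) [Group G]
    (hG : IsPPi π G) (hsol : Group.IsSolvable G) (hloc : ¬ IsPiLocal π G)
    (hvn : ¬ Group.IsVirtuallyNilpotent G)
    (Gπ : Type u) [Group Gπ] (φ : G →* Gπ) (hφ : IsPiLocalization π φ) :
    ¬ Group.IsSolvable Gπ := by
  intro hGπ
  obtain ⟨x, hx⟩ : ∃ x : G, LacksRoot π x := by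
    by_contra! h
    refine hloc fun q hq => ⟨hG.isUPi q (isPrimeToSet_prime hq), fun x => ?_⟩
    by_contra hr
    exact h x ⟨q, isPrimeToSet_prime hq, fun y hy => hr ⟨y, hy⟩⟩
  obtain ⟨Γ, _, f, -, hΓ, -, hgen, himp⟩ := hG.isRootTame.exists_extension hx
  obtain ⟨L, _, e, he, hL⟩ := hΓ.exists_isPiLocal
  obtain ⟨ψ, hψ, -⟩ := hφ.existsUnique_lift L hL (e.comp f)
  -- Roots of elements of `G` exist in `G_π` and are unique in `L`, so those lying in `Γ` belong to
  -- the image of `ψ`; together with `G` they generate `Γ`.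
  have htop : ψ.range.comap e = ⊤ := by
    refine hgen _ ?_ fun y m hm ⟨g, hg⟩ => ?_
    · rintro _ ⟨g, rfl⟩
      exact ⟨φ g, DFunLike.congr_fun hψ g⟩
    · obtain ⟨z, hz⟩ := (hφ.isPiLocal.bijective_pow hm).2 (φ g)
      refine ⟨z, hL.isUPi m hm ?_⟩
      simp only at hz ⊢
      rw [← map_pow, ← map_pow, hz, ← hg]
      exact DFunLike.congr_fun hψ g
  refine hvn (himp ?_)
  let e' : Γ →* ψ.range := e.codRestrict ψ.range fun w => by
    have : w ∈ ψ.range.comap e := htop ▸ Subgroup.mem_top w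
    exact this
  have hr : Group.IsSolvable ψ.range := Group.isSolvable_of_surjective ψ.rangeRestrict_surjective
  exact Group.isSolvable_of_isSolvable_injective (f := e') fun a b hab =>
    he (congrArg Subtype.val hab)
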